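/- Let $n\ge 2$, let $\Omega\subset\mathbb{R}^n$ be a bounded domain, let $T\in(0,\infty)$ and $\Omega_T=\Omega\times(0,T)$. Let $p_1,\dots,p_n>1$, $\delta_1,\dots,\delta_n\ge 0$ and $\Lambda\ge 1$ be real numbers, and let $a_1,\dots,a_n:\Omega_T\to\mathbb{R}$ be measurable with $\Lambda^{-1}\le a_i(x,t)\le\Lambda$ for a.e. $(x,t)\in\Omega_T$. Consider the equation $$\partial_t u=\sum_{i=1}^n\partial_{x_i}\Big[a_i(x,t)\,(|\partial_{x_i}u|-\delta_i)_+^{p_i-1}\,\frac{\partial_{x_i}u}{|\partial_{x_i}u|}\Big]\quad\text{in }\Omega_T, \qquad (*)$$ where the term in brackets is understood to be $0$ where $\partial_{x_i}u=0$. Put $P=\max\{2,p_1,\dots,p_n\}$. A function $u:\Omega_T\to\mathbb{R}$ is a local weak supersolution (resp. subsolution) of $(*)$ if $u\in L^P_{loc}(\Omega_T)\cap L^1_{loc}(0,T;W^{1,1}_{loc}(\Omega))$, its weak spatial derivatives satisfy $\partial_{x_i}u\in L^{p_i}_{loc}(\Omega_T)$ for $i=1,\dots,n$, and $$\iint_{\Omega_T}\Big(u\,\partial_t\varphi-\sum_{i=1}^n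 a_i(x,t)\,(|\partial_{x_i}u|-\delta_i)_+^{p_i-1}\,\frac{\partial_{x_i}u}{|\partial_{x_i}u|}\,\partial_{x_i}\varphi\Big)\,dx\,dt\;\le\;0\quad(\text{resp. }\ge 0)$$ for all $\varphi\in C_0^\infty(\Omega_T)$ with $\varphi\ge 0$. **Theorem.** If $u$ is a local weak supersolution of $(*)$ which is locally essentially bounded from below in $\Omega_T$ (that is, bounded from below a.e. on each compact subset of $\Omega_T$), then $u$ has a lower semicontinuous representative in $\Omega_T$: there is a lower semicontinuous function $v:\Omega_T\to(-\infty,+\infty]$ with $v=u$ a.e. in $\Omega_T$. Likewise, if $u$ is a local weak subsolution of $(*)$ which is locally essentially bounded from above in $\Omega_T$, then there is an upper semicontinuous function $v:\Omega_T\to[-\infty,+\infty)$ with $v=u$ a.e. in $\Omega_T$. -/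

import Mathlib

open MeasureTheory Set
open scoped ContDiff

noncomputable section

namespace WidelyDegenerate

/-- The space-time cylinder `Ω_T = Ω × (0, T)`. -/
def cylinder {n : ℕ} (Ω : Set (EuclideanSpace ℝ (Fin n))) (T : ℝ) :
    Set (EuclideanSpace ℝ (Fin n) × ℝ) :=
  Ω ×ˢ Ioo 0 T

/-- `f ∈ L^q_loc(U)`: `f` belongs to `L^q(K)` for every compact `K ⊆ U`. -/
def MemLpLoc {X : Type*} [TopologicalSpace X] [MeasureSpace X]
    (f : X → ℝ) (q : ℝ) (U : Set X) : Prop :=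
  ∀ K : Set X, IsCompact K → K ⊆ U → MemLp f (ENNReal.ofReal q) (volume.restrict K)

/-- `φ ∈ C₀^∞(U)`: smooth, with compact support contained in `U`. -/
structure IsTestFunction {X : Type*} [NormedAddCommGroup X] [NormedSpace ℝ X]
    (U : Set X) (φ : X → ℝ) : Prop where
  smooth : ContDiff ℝ ∞ φ
  compact_support : HasCompactSupport φ
  support_subset : tsupport φ ⊆ U

/-- `f ∈ W^{1,1}_loc(Ω)` with weak gradient `g = (g₁, …, gₙ)`. -/
structure MemW11Loc {n : ℕ} (Ω : Set (EuclideanSpace ℝ (Fin n)))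
    (f : EuclideanSpace ℝ (Fin n) → ℝ) (g : Fin n → EuclideanSpace ℝ (Fin n) → ℝ) : Prop where
  memLpLoc : MemLpLoc f 1 Ω
  grad_memLpLoc : ∀ i, MemLpLoc (g i) 1 Ω
  integral_eq : ∀ i, ∀ φ : EuclideanSpace ℝ (Fin n) → ℝ, IsTestFunction Ω φ →
    ∫ x in Ω, f x * fderiv ℝ φ x (EuclideanSpace.single i 1) = - ∫ x in Ω, g i x * φ x

/-- `u ∈ L^𝐩_loc(0, T; W^{1,𝐩}_loc(Ω))` with spatial weak gradient `g = Du`: the function `u` is in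
`L^1_loc(0, T; W^{1,1}_loc(Ω))`, and `∂_{x_i} u ∈ L^{p_i}_loc(Ω_T)` for every `i`. -/
structure MemParabolicSobolevLoc {n : ℕ} (Ω : Set (EuclideanSpace ℝ (Fin n))) (T : ℝ)
    (p : Fin n → ℝ) (u : EuclideanSpace ℝ (Fin n) × ℝ → ℝ)
    (g : Fin n → EuclideanSpace ℝ (Fin n) × ℝ → ℝ) : Prop where
  memLpLoc_one : MemLpLoc u 1 (cylinder Ω T)
  grad_memLpLoc_one : ∀ i, MemLpLoc (g i) 1 (cylinder Ω T)
  slice : ∀ᵐ t ∂(volume.restrict (Ioo 0 T)),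
    MemW11Loc Ω (fun x => u (x, t)) (fun i x => g i (x, t))
  grad_memLpLoc : ∀ i, MemLpLoc (g i) (p i) (cylinder Ω T)

/-- The exponent `P = max {2, p₁, …, pₙ}`. -/
def maxExponent {n : ℕ} (p : Fin n → ℝ) : ℝ :=
  max 2 (⨆ i, p i)

/-- The scalar function `s ↦ (|s| - δ)₊^{q-1} s / |s|`, which is `0` at `s = 0` and is, for `q > 1`
and `δ ≥ 0`, the derivative of `s ↦ (|s| - δ)₊^q / q`. -/
def degenerateFlux (q δ s : ℝ) : ℝ :=
  (max (|s| - δ) 0) ^ (q - 1) * (s / |s|)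

/-- The weak form `∬_{Ω_T} (u ∂_t φ - ⟨D_ξ F(x, t, Du), Dφ⟩) dx dt`, with `Du` given by `g` and
`F(x, t, ξ) = ∑ i, (a_i(x, t) / p_i) (|ξ_i| - δ_i)₊^{p_i}`. -/
def weakForm {n : ℕ} (Ω : Set (EuclideanSpace ℝ (Fin n))) (T : ℝ) (p δ : Fin n → ℝ)
    (a : Fin n → EuclideanSpace ℝ (Fin n) × ℝ → ℝ) (u : EuclideanSpace ℝ (Fin n) × ℝ → ℝ)
    (g : Fin n → EuclideanSpace ℝ (Fin n) × ℝ → ℝ) (φ : EuclideanSpace ℝ (Fin n) × ℝ → ℝ) : ℝ :=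
  ∫ z in cylinder Ω T,
    (u z * fderiv ℝ φ z (0, 1)
      - ∑ i, a i z * degenerateFlux (p i) (δ i) (g i z)
          * fderiv ℝ φ z (EuclideanSpace.single i 1, 0))

/-- `u` is a local weak supersolution in `Ω_T` of
`∂_t u = ∑ i, ∂_{x_i} [a_i (|∂_{x_i} u| - δ_i)₊^{p_i - 1} ∂_{x_i} u / |∂_{x_i} u|]`. -/
def IsLocalWeakSupersolution {n : ℕ} (Ω : Set (EuclideanSpace ℝ (Fin n))) (T : ℝ)
    (p δ : Fin n → ℝ) (a : Fin n → EuclideanSpace ℝ (Fin n) × ℝ → ℝ)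
    (u : EuclideanSpace ℝ (Fin n) × ℝ → ℝ) : Prop :=
  MemLpLoc u (maxExponent p) (cylinder Ω T) ∧
  ∃ g : Fin n → EuclideanSpace ℝ (Fin n) × ℝ → ℝ,
    MemParabolicSobolevLoc Ω T p u g ∧
    ∀ φ : EuclideanSpace ℝ (Fin n) × ℝ → ℝ, IsTestFunction (cylinder Ω T) φ → (∀ z, 0 ≤ φ z) →
      weakForm Ω T p δ a u g φ ≤ 0

/-- `u` is a local weak subsolution in `Ω_T` of the same equation. -/
def IsLocalWeakSubsolution {n : ℕ} (Ω : Set (EuclideanSpace ℝ (Fin n))) (T : ℝ)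
    (p δ : Fin n → ℝ) (a : Fin n → EuclideanSpace ℝ (Fin n) × ℝ → ℝ)
    (u : EuclideanSpace ℝ (Fin n) × ℝ → ℝ) : Prop :=
  MemLpLoc u (maxExponent p) (cylinder Ω T) ∧
  ∃ g : Fin n → EuclideanSpace ℝ (Fin n) × ℝ → ℝ,
    MemParabolicSobolevLoc Ω T p u g ∧
    ∀ φ : EuclideanSpace ℝ (Fin n) × ℝ → ℝ, IsTestFunction (cylinder Ω T) φ → (∀ z, 0 ≤ φ z) →
      0 ≤ weakForm Ω T p δ a u g φ

/-- `u` is locally (essentially) bounded from below in `U`. -/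
def LocallyBddBelow {X : Type*} [TopologicalSpace X] [MeasureSpace X]
    (u : X → ℝ) (U : Set X) : Prop :=
  ∀ K : Set X, IsCompact K → K ⊆ U → ∃ m : ℝ, ∀ᵐ z ∂(volume.restrict K), m ≤ u z

/-- `u` is locally (essentially) bounded from above in `U`. -/
def LocallyBddAbove {X : Type*} [TopologicalSpace X] [MeasureSpace X]
    (u : X → ℝ) (U : Set X) : Prop :=
  ∀ K : Set X, IsCompact K → K ⊆ U → ∃ m : ℝ, ∀ᵐ z ∂(volume.restrict K), u z ≤ m

/-- `u` has a representative, with values in `(-∞, +∞]`, that is lower semicontinuous in `U`. -/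
def HasLscRepresentative {X : Type*} [TopologicalSpace X] [MeasureSpace X]
    (u : X → ℝ) (U : Set X) : Prop :=
  ∃ v : X → EReal, LowerSemicontinuousOn v U ∧ (∀ z ∈ U, v z ≠ ⊥) ∧
    ∀ᵐ z ∂(volume.restrict U), v z = (u z : EReal)

/-- `u` has a representative, with values in `[-∞, +∞)`, that is upper semicontinuous in `U`. -/
def HasUscRepresentative {X : Type*} [TopologicalSpace X] [MeasureSpace X]
    (u : X → ℝ) (U : Set X) : Prop :=
  ∃ v : X → EReal, UpperSemicontinuousOn v U ∧ (∀ z ∈ U, v z ≠ ⊤) ∧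
    ∀ᵐ z ∂(volume.restrict U), v z = (u z : EReal)

end WidelyDegenerate

end

/-! Lower semicontinuity reduces to a statement about level sets: for `c < d`, almost every point
where `u > d` has a neighbourhood on which `u ≥ c` almost everywhere. The representative is then a
supremum over rational levels (`hasLscRepresentative_of_null`).

The analytic input is a De Giorgi lemma (`exists_ae_le_of_measure_le`): if a supersolution lies
below `k` only on a set of small measure, it stays above a slightly lower level near the centre.
Neither the different exponents nor the degeneracy matters here, because only a linear form of
coercivity is used: `|s| + c |F(s)| ≤ F(s) s + C` for the flux `F` (`exists_abs_add_le_flux_mul`).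
Testing with the square of `v = (k - w)₊` bounds `sup_t ∫ v³` and `∬ |D(v²)|` by a multiple of `∬
v`; the constant `C` costs only `∬ v`. The `W^{1,1}` Sobolev inequality on time slices turns this
into a bound for `∬ v^{2+3/n}`, hence into a recursion between levels with exponent `1 + 1/n`. No
cutoff is needed: `w` is the supersolution plus `M (|x|² + t²)`, which confines `{w < k}` to the
unit ball.

The differential inequality is linear in the pair (solution, flux), so both are mollified separately
and all computations are classical. Only coercivity is nonlinear; it survives up to an error tending
to `0` in `L¹`.

The dilations with `r_i ^ p_i = τ` preserve the class of equations and the values of `u`, and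
replace `δ_i` by `r_i δ_i ≤ δ_i`. The smallness constant `ν` is therefore the same in all small
cylinders. If the exceptional set for `c < d` had positive measure, it would contain a compact `A`
of positive measure, disjoint from `{u < d}`. An averaging argument
(`exists_measure_setOf_add_mem_le`), in place of a density theorem for anisotropic cylinders, finds
a centre in `A` where the De Giorgi lemma applies: a contradiction. Subsolutions follow by negation,
since the flux is odd. -/

namespace WidelyDegenerate

open Filter Metric Topology ContinuousLinearMap
open scoped ENNReal NNReal Convolution

/-! ### Mollification and its convergence in `L^p` -/

section Mollification

variable {G : Type*} [NormedAddCommGroup G] [NormedSpace ℝ G] [FiniteDimensional ℝ G]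
  [MeasurableSpace G] [BorelSpace G] {μ : Measure G} [μ.IsAddHaarMeasure]

/-- The mollification of `f` by the normalized bump function `φ`. -/
noncomputable def mollify (μ : Measure G) (φ : ContDiffBump (0 : G)) (f : G → ℝ) : G → ℝ :=
  φ.normed μ ⋆[lsmul ℝ ℝ, μ] f

theorem mollify_apply (φ : ContDiffBump (0 : G)) (f : G → ℝ) (x : G) :
    mollify μ φ f x = ∫ t, φ.normed μ (x - t) * f t ∂μ := by
  simp only [mollify, convolution_lsmul_swap, smul_eq_mul]

theorem contDiff_mollify (φ : ContDiffBump (0 : G)) {f : G → ℝ} (hf : LocallyIntegrable f μ) :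
    ContDiff ℝ 1 (mollify μ φ f) :=
  φ.hasCompactSupport_normed.contDiff_convolution_left (n := 1) _ φ.contDiff_normed hf

theorem fderiv_mollify (φ : ContDiffBump (0 : G)) {f : G → ℝ} (hf : LocallyIntegrable f μ)
    (x v : G) :
    fderiv ℝ (mollify μ φ f) x v = ∫ t, fderiv ℝ (φ.normed μ) (x - t) v * f t ∂μ := by
  have h := φ.hasCompactSupport_normed.hasFDerivAt_convolution_left (lsmul ℝ ℝ)
    (φ.contDiff_normed (n := 1) (μ := μ)) hf x
  rw [mollify, h.fderiv, convolution_eq_swap, ContinuousLinearMap.integral_apply]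
  · simp [precompL_apply]
  · have := (φ.hasCompactSupport_normed.fderiv ℝ).convolutionExists_left
      ((lsmul ℝ ℝ : ℝ →L[ℝ] ℝ →L[ℝ] ℝ).precompL G)
      ((φ.contDiff_normed (n := 1) (μ := μ)).continuous_fderiv one_ne_zero) hf x
    exact this.integrable_swap

theorem le_mollify (φ : ContDiffBump (0 : G)) {f : G → ℝ} (hf : LocallyIntegrable f μ) {m : ℝ}
    (hm : ∀ᵐ x ∂μ, m ≤ f x) (x : G) : m ≤ mollify μ φ f x := by
  have h1 : m = ∫ t, φ.normed μ (x - t) * m ∂μ := by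
    rw [integral_mul_const, integral_sub_left_eq_self (φ.normed μ) μ x, φ.integral_normed, one_mul]
  have h2 : Integrable (fun t ↦ φ.normed μ (x - t) * m) μ :=
    (φ.integrable_normed.comp_sub_left x).mul_const m
  have h3 : Integrable (fun t ↦ φ.normed μ (x - t) * f t) μ := by
    have := φ.hasCompactSupport_normed.convolutionExists_left (lsmul ℝ ℝ)
      (φ.continuous_normed (μ := μ)) hf x
    simpa using this.integrable_swap
  rw [mollify_apply]
  conv_lhs => rw [h1]
  refine integral_mono_ae h2 h3 ?_
  filter_upwards [hm] with t ht
  exact mul_le_mul_of_nonneg_left ht (φ.nonneg_normed _)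

theorem mollify_congr (φ : ContDiffBump (0 : G)) {f g : G → ℝ} (h : f =ᵐ[μ] g) :
    mollify μ φ f = mollify μ φ g :=
  convolution_congr _ EventuallyEq.rfl h

theorem mollify_sub (φ : ContDiffBump (0 : G)) {f g : G → ℝ} (hf : LocallyIntegrable f μ)
    (hg : LocallyIntegrable g μ) : mollify μ φ (f - g) = mollify μ φ f - mollify μ φ g := by
  have key : ∀ {f : G → ℝ}, LocallyIntegrable f μ → ∀ x,
      Integrable (fun t ↦ φ.normed μ (x - t) * f t) μ := fun {f} hf x ↦ by
    have := φ.hasCompactSupport_normed.convolutionExists_left (lsmul ℝ ℝ)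
      (φ.continuous_normed (μ := μ)) hf x
    simpa using this.integrable_swap
  ext x
  simp only [Pi.sub_apply, mollify_apply, mul_sub]
  exact integral_sub (key hf x) (key hg x)

/-- Jensen's inequality for the probability measure with density `φ.normed μ`, followed by Tonelli
and translation invariance. Passing to a strongly measurable version of `f` makes `(x, t) ↦ f (x -
t)` jointly measurable. -/
theorem eLpNorm_mollify_le (φ : ContDiffBump (0 : G)) {f : G → ℝ} {p : ℝ} (hp : 1 ≤ p)
    (hf : AEStronglyMeasurable f μ) :
    eLpNorm (mollify μ φ f) (ENNReal.ofReal p) μ ≤ eLpNorm f (ENNReal.ofReal p) μ := by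
  rw [mollify_congr φ hf.ae_eq_mk, eLpNorm_congr_ae hf.ae_eq_mk]
  have hg := hf.stronglyMeasurable_mk
  generalize hf.mk f = g at hg
  have hp0 : 0 < p := by linarith
  have e1 : ENNReal.ofReal p ≠ 0 := by simpa using hp0
  set ν : Measure G := μ.withDensity fun t ↦ ENNReal.ofReal (φ.normed μ t) with hν
  have hφm : Measurable fun t ↦ ENNReal.ofReal (φ.normed μ t) :=
    φ.continuous_normed.measurable.ennreal_ofReal
  have hν1 : IsProbabilityMeasure ν := by
    constructor
    rw [hν, withDensity_apply _ MeasurableSet.univ, Measure.restrict_univ,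
      ← ofReal_integral_eq_lintegral_ofReal φ.integrable_normed
        (ae_of_all _ φ.nonneg_normed), φ.integral_normed, ENNReal.ofReal_one]
  rw [eLpNorm_eq_lintegral_rpow_enorm_toReal e1 ENNReal.ofReal_ne_top,
    eLpNorm_eq_lintegral_rpow_enorm_toReal e1 ENNReal.ofReal_ne_top, ENNReal.toReal_ofReal hp0.le]
  refine ENNReal.rpow_le_rpow ?_ (by positivity)
  have hmeas : Measurable fun q : G × G ↦ ‖g (q.1 - q.2)‖ₑ ^ p :=
    (hg.measurable.comp (measurable_fst.sub measurable_snd)).enorm.pow_const p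
  calc ∫⁻ x, ‖mollify μ φ g x‖ₑ ^ p ∂μ
      ≤ ∫⁻ x, ∫⁻ t, ‖g (x - t)‖ₑ ^ p ∂ν ∂μ := by
        refine lintegral_mono fun x ↦ ?_
        have hgx : Measurable fun t ↦ g (x - t) := hg.measurable.comp (measurable_const.sub measurable_id)
        have h1 : ‖mollify μ φ g x‖ₑ ≤ ∫⁻ t, ‖g (x - t)‖ₑ ∂ν := by
          rw [mollify, convolution_lsmul]
          refine (enorm_integral_le_lintegral_enorm _).trans_eq ?_
          rw [hν, lintegral_withDensity_eq_lintegral_mul _ hφm hgx.enorm]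
          refine lintegral_congr fun t ↦ ?_
          rw [Pi.mul_apply, smul_eq_mul, enorm_mul, Real.enorm_eq_ofReal (φ.nonneg_normed t)]
        have h2 := eLpNorm'_le_eLpNorm'_of_exponent_le (zero_lt_one) hp ν
          hgx.aestronglyMeasurable
        simp only [eLpNorm', ENNReal.rpow_one, div_one] at h2
        calc ‖mollify μ φ g x‖ₑ ^ p ≤ ((∫⁻ t, ‖g (x - t)‖ₑ ^ p ∂ν) ^ (1 / p)) ^ p :=
              ENNReal.rpow_le_rpow (h1.trans h2) hp0.le
          _ = _ := by rw [← ENNReal.rpow_mul, one_div, inv_mul_cancel₀ hp0.ne', ENNReal.rpow_one]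
    _ = ∫⁻ t, ∫⁻ x, ‖g (x - t)‖ₑ ^ p ∂μ ∂ν := lintegral_lintegral_swap hmeas.aemeasurable
    _ = ∫⁻ t, ∫⁻ x, ‖g x‖ₑ ^ p ∂μ ∂ν := by
        refine lintegral_congr fun t ↦ ?_
        exact lintegral_sub_right_eq_self (fun x ↦ ‖g x‖ₑ ^ p) t
    _ = _ := by simp

/-- An `ε/3` argument: continuous functions of compact support are dense in `L^p`, mollification is
a contraction, and for such a function the convergence is uniform with supports in one fixed compact
set. -/
theorem tendsto_eLpNorm_mollify_sub {p : ℝ} (hp : 1 ≤ p) {f : G → ℝ}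
    (hf : MemLp f (ENNReal.ofReal p) μ) {φ : ℕ → ContDiffBump (0 : G)}
    (hφ : Tendsto (fun j ↦ (φ j).rOut) atTop (𝓝 0)) :
    Tendsto (fun j ↦ eLpNorm (mollify μ (φ j) f - f) (ENNReal.ofReal p) μ) atTop (𝓝 0) := by
  have hp1 : (1 : ℝ≥0∞) ≤ ENNReal.ofReal p := by simpa using hp
  refine ENNReal.tendsto_nhds_zero.2 fun ε hε ↦ ?_
  have hε3 : ε / 3 ≠ 0 := (ENNReal.div_pos hε.ne' (by norm_num)).ne'
  obtain ⟨g, hgs, hfg, hgc, hgm⟩ :=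
    hf.exists_hasCompactSupport_eLpNorm_sub_le ENNReal.ofReal_ne_top hε3
  have hfl : LocallyIntegrable f μ := hf.locallyIntegrable hp1
  have hgl : LocallyIntegrable g μ := hgm.locallyIntegrable hp1
  set K := cthickening 1 (tsupport g) with hK
  have hKc : IsCompact K := hgs.isCompact.cthickening
  have hgu : UniformContinuous g := hgs.uniformContinuous_of_continuous hgc
  obtain ⟨η, hη, hη3⟩ : ∃ η : ℝ, 0 < η ∧
      μ K ^ (1 / p) * ENNReal.ofReal η ≤ ε / 3 := by
    have hfin : μ K ^ (1 / p) ≠ ⊤ :=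
      ENNReal.rpow_ne_top_of_nonneg (by positivity) hKc.measure_lt_top.ne
    have : Tendsto (fun η : ℝ ↦ μ K ^ (1 / p) * ENNReal.ofReal η) (𝓝[>] 0) (𝓝 0) := by
      have h0 : Tendsto (fun η : ℝ ↦ ENNReal.ofReal η) (𝓝[>] 0) (𝓝 0) := by
        simpa using (ENNReal.continuous_ofReal.tendsto 0).mono_left nhdsWithin_le_nhds
      simpa using ENNReal.Tendsto.const_mul h0 (Or.inr hfin)
    obtain ⟨η, h1, h2⟩ := ((this.eventually (ge_mem_nhds (pos_iff_ne_zero.2 hε3))).and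
      self_mem_nhdsWithin).exists
    exact ⟨η, h2, h1⟩
  obtain ⟨d, hd, hgd⟩ := Metric.uniformContinuous_iff.1 hgu η hη
  filter_upwards [hφ.eventually (gt_mem_nhds (lt_min hd one_pos))] with j hj
  have hmid : eLpNorm (mollify μ (φ j) g - g) (ENNReal.ofReal p) μ ≤ ε / 3 := by
    have hz : ∀ x ∉ K, ∀ y ∈ ball x (φ j).rOut, g y = 0 := by
      intro x hx y hy
      by_contra hne
      refine hx (mem_cthickening_of_dist_le x y 1 _ (subset_tsupport g hne) ?_)
      rw [dist_comm]
      exact ((mem_ball.1 hy).trans (hj.trans_le (min_le_right _ _))).le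
    have hb : ∀ x, ‖(mollify μ (φ j) g - g) x‖ ≤ ‖K.indicator (fun _ ↦ η) x‖ := by
      intro x
      by_cases hx : x ∈ K
      · rw [indicator_of_mem hx, Pi.sub_apply, ← dist_eq_norm, Real.norm_of_nonneg hη.le]
        refine ContDiffBump.dist_normed_convolution_le hgc.aestronglyMeasurable fun y hy ↦ ?_
        exact (hgd ((mem_ball.1 hy).trans (hj.trans_le (min_le_left _ _)))).le
      · rw [indicator_of_notMem hx, Pi.sub_apply, ← dist_eq_norm, norm_zero]
        refine ContDiffBump.dist_normed_convolution_le hgc.aestronglyMeasurable fun y hy ↦ ?_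
        rw [hz x hx y hy, hz x hx x (mem_ball_self (φ j).rOut_pos), dist_self]
    refine (eLpNorm_mono hb).trans ?_
    rw [eLpNorm_indicator_const hKc.measurableSet (zero_lt_one.trans_le hp1).ne'
      ENNReal.ofReal_ne_top, ENNReal.toReal_ofReal (by linarith), mul_comm,
      Real.enorm_eq_ofReal hη.le]
    exact hη3
  have hmm : ∀ {f : G → ℝ}, LocallyIntegrable f μ → AEStronglyMeasurable (mollify μ (φ j) f) μ :=
    fun h ↦ (contDiff_mollify (φ j) h).continuous.aestronglyMeasurable
  have hsplit : mollify μ (φ j) f - f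
      = mollify μ (φ j) (f - g) + ((mollify μ (φ j) g - g) + (g - f)) := by
    rw [mollify_sub _ hfl hgl]; abel
  have hgf : eLpNorm (g - f) (ENNReal.ofReal p) μ ≤ ε / 3 := by
    rwa [← neg_sub, eLpNorm_neg]
  have hfgm : AEStronglyMeasurable (f - g) μ := hf.1.sub hgm.1
  rw [hsplit]
  calc _ ≤ eLpNorm (mollify μ (φ j) (f - g)) (ENNReal.ofReal p) μ
        + (eLpNorm (mollify μ (φ j) g - g) (ENNReal.ofReal p) μ
          + eLpNorm (g - f) (ENNReal.ofReal p) μ) := by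
        refine (eLpNorm_add_le (hmm (hfl.sub hgl)) (((hmm hgl).sub hgm.1).add (hgm.1.sub hf.1))
          hp1).trans (add_le_add le_rfl (eLpNorm_add_le ((hmm hgl).sub hgm.1) (hgm.1.sub hf.1) hp1))
    _ ≤ ε / 3 + (ε / 3 + ε / 3) :=
        add_le_add ((eLpNorm_mollify_le (φ j) hp hfgm).trans hfg) (add_le_add hmid hgf)
    _ = ε := by rw [← add_assoc]; exact ENNReal.add_thirds ε

end Mollification


/-! ### Powers of truncations, time slices and integration by parts -/

/-- An exponent of at least `2` makes powers of the positive part `C¹` across `0`, so the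
truncations used as test functions need no weak derivatives. -/
theorem hasDerivAt_max_zero_pow (j : ℕ) (s : ℝ) :
    HasDerivAt (fun s : ℝ ↦ max s 0 ^ (j + 2)) ((j + 2 : ℕ) * max s 0 ^ (j + 1)) s := by
  rcases lt_trichotomy s 0 with hs | rfl | hs
  · rw [max_eq_right hs.le, zero_pow (by omega), mul_zero]
    refine (hasDerivAt_const s (0 : ℝ)).congr_of_eventuallyEq ?_
    filter_upwards [gt_mem_nhds hs] with y hy
    rw [max_eq_right hy.le, zero_pow (by omega)]
  · rw [max_self, zero_pow (by omega), mul_zero, hasDerivAt_iff_isLittleO]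
    simp only [max_self, zero_pow (Nat.succ_ne_zero _), sub_zero, smul_zero]
    have h1 : (fun y : ℝ ↦ y ^ (j + 2)) =o[𝓝 0] fun y ↦ y ^ 1 := Asymptotics.isLittleO_pow_pow (by omega)
    refine (Asymptotics.IsBigO.of_bound 1 (Eventually.of_forall fun y ↦ ?_)).trans_isLittleO
      (by simpa using h1)
    rw [one_mul, norm_pow, norm_pow]
    refine pow_le_pow_left₀ (norm_nonneg _) ?_ _
    rw [Real.norm_eq_abs, Real.norm_eq_abs, abs_of_nonneg (le_max_right _ _)]
    exact max_le (le_abs_self y) (abs_nonneg y)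
  · rw [max_eq_left hs.le]
    refine (hasDerivAt_pow (j + 2) s).congr_of_eventuallyEq ?_
    filter_upwards [lt_mem_nhds hs] with y hy
    rw [max_eq_left hy.le]

theorem contDiff_max_zero_pow (j : ℕ) : ContDiff ℝ 1 (fun s : ℝ ↦ max s 0 ^ (j + 2)) := by
  rw [contDiff_one_iff_deriv]
  refine ⟨fun s ↦ (hasDerivAt_max_zero_pow j s).differentiableAt, ?_⟩
  rw [funext fun s ↦ (hasDerivAt_max_zero_pow j s).deriv]
  fun_prop

section Truncation

variable {X : Type*} [NormedAddCommGroup X] [NormedSpace ℝ X] {w : X → ℝ} {k : ℝ}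

theorem contDiff_trunc_pow (hw : ContDiff ℝ 1 w) (k : ℝ) (j : ℕ) :
    ContDiff ℝ 1 fun z ↦ max (k - w z) 0 ^ (j + 2) :=
  (contDiff_max_zero_pow j).comp (contDiff_const.sub hw)

theorem fderiv_trunc_pow (hw : ContDiff ℝ 1 w) (k : ℝ) (j : ℕ) (z e : X) :
    fderiv ℝ (fun z ↦ max (k - w z) 0 ^ (j + 2)) z e
      = -((j + 2 : ℕ) * max (k - w z) 0 ^ (j + 1) * fderiv ℝ w z e) := by
  have h1 : HasFDerivAt (fun z ↦ k - w z) (-fderiv ℝ w z) z :=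
    ((hw.differentiable one_ne_zero z).hasFDerivAt).const_sub k
  have h2 := (hasDerivAt_max_zero_pow j (k - w z)).comp_hasFDerivAt z h1
  rw [HasFDerivAt.fderiv (f := fun z ↦ max (k - w z) 0 ^ (j + 2)) h2]
  simp

end Truncation

/-- The norm of a functional on Euclidean space is at most the sum of its absolute values on
the standard basis. -/
theorem norm_le_sum_abs_single {n : ℕ} (ℓ : EuclideanSpace ℝ (Fin n) →L[ℝ] ℝ) :
    ‖ℓ‖ ≤ ∑ i, |ℓ (EuclideanSpace.single i 1)| := by
  refine ℓ.opNorm_le_bound (Finset.sum_nonneg fun i _ ↦ abs_nonneg _) fun x ↦ ?_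
  have hx : x = ∑ i, x i • EuclideanSpace.single i (1 : ℝ) := by
    simpa using ((EuclideanSpace.basisFun (Fin n) ℝ).sum_repr x).symm
  conv_lhs => rw [hx]
  rw [map_sum, Finset.sum_mul]
  refine (norm_sum_le _ _).trans (Finset.sum_le_sum fun i _ ↦ ?_)
  rw [map_smul, norm_smul, mul_comm, Real.norm_eq_abs (ℓ _)]
  exact mul_le_mul_of_nonneg_left (PiLp.norm_apply_le x i) (abs_nonneg _)

section CompactSupport

theorem hasCompactSupport_trunc {X : Type*} [TopologicalSpace X] [R1Space X] {w : X → ℝ} {k : ℝ}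
    {K : Set X} (hK : IsCompact K) (hwK : ∀ z, w z < k → z ∈ K) :
    HasCompactSupport fun z ↦ max (k - w z) 0 :=
  HasCompactSupport.intro hK fun z hz ↦ max_eq_right (by
    have := mt (hwK z) hz
    linarith)

variable {E : Type*} [TopologicalSpace E]

theorem hasCompactSupport_slice_left [R1Space E] {f : E × ℝ → ℝ} (hf : HasCompactSupport f) (t : ℝ) :
    HasCompactSupport fun x ↦ f (x, t) :=
  HasCompactSupport.intro (hf.isCompact.image continuous_fst) fun x hx ↦ by
    by_contra hne
    exact hx ⟨(x, t), subset_tsupport f hne, rfl⟩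

theorem hasCompactSupport_slice_right {f : E × ℝ → ℝ} (hf : HasCompactSupport f) (x : E) :
    HasCompactSupport fun t ↦ f (x, t) :=
  HasCompactSupport.intro (hf.isCompact.image continuous_snd) fun t ht ↦ by
    by_contra hne
    exact ht ⟨(x, t), subset_tsupport f hne, rfl⟩

end CompactSupport

section Slices

variable {E : Type*} [NormedAddCommGroup E] [NormedSpace ℝ E]

theorem contDiff_slice {f : E × ℝ → ℝ} (hf : ContDiff ℝ 1 f) (t : ℝ) :
    ContDiff ℝ 1 fun x ↦ f (x, t) := hf.comp (contDiff_id.prodMk contDiff_const)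

theorem fderiv_slice {f : E × ℝ → ℝ} (hf : ContDiff ℝ 1 f) (t : ℝ) (x e : E) :
    fderiv ℝ (fun x ↦ f (x, t)) x e = fderiv ℝ f (x, t) (e, 0) := by
  have h := HasFDerivAt.comp x (hf.differentiable one_ne_zero (x, t)).hasFDerivAt
    (hasFDerivAt_prodMk_left (𝕜 := ℝ) x t)
  rw [HasFDerivAt.fderiv (f := fun x ↦ f (x, t)) h]
  simp

theorem deriv_slice {f : E × ℝ → ℝ} (hf : ContDiff ℝ 1 f) (x : E) (t : ℝ) :
    deriv (fun t ↦ f (x, t)) t = fderiv ℝ f (x, t) (0, 1) := by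
  have h := HasFDerivAt.comp t (hf.differentiable one_ne_zero (x, t)).hasFDerivAt
    (hasFDerivAt_prodMk_right (𝕜 := ℝ) x t)
  rw [HasDerivAt.deriv (HasFDerivAt.hasDerivAt (f := fun t ↦ f (x, t)) h)]
  simp

variable [FiniteDimensional ℝ E] [MeasureSpace E] [BorelSpace E]
  [(volume : Measure E).IsAddHaarMeasure]

theorem setIntegral_Iic_fderiv_snd {f : E × ℝ → ℝ} (hf : ContDiff ℝ 1 f)
    (hc : HasCompactSupport f) (s : ℝ) :
    ∫ z in univ ×ˢ Iic s, fderiv ℝ f z (0, 1) = ∫ x, f (x, s) := by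
  have hint : Integrable (fun z ↦ fderiv ℝ f z ((0 : E), (1 : ℝ))) :=
    ((hf.continuous_fderiv one_ne_zero).clm_apply continuous_const).integrable_of_hasCompactSupport
      (hc.fderiv_apply ℝ _)
  rw [Measure.volume_eq_prod, setIntegral_prod _ (by
    rw [← Measure.volume_eq_prod]; exact hint.integrableOn), Measure.restrict_univ]
  refine integral_congr_ae (ae_of_all _ fun x ↦ ?_)
  have h1 : ContDiff ℝ 1 fun t ↦ f (x, t) := hf.comp (contDiff_const.prodMk contDiff_id)
  have h2 := HasCompactSupport.integral_Iic_deriv_eq h1 (hasCompactSupport_slice_right hc x) s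
  simpa only [deriv_slice hf] using h2

theorem setIntegral_Iic_mul_fderiv_fst {f g : E × ℝ → ℝ} (hf : ContDiff ℝ 1 f)
    (hg : ContDiff ℝ 1 g) (hc : HasCompactSupport g) (s : ℝ) (e : E) :
    ∫ z in univ ×ˢ Iic s, f z * fderiv ℝ g z (e, 0)
      = -∫ z in univ ×ˢ Iic s, fderiv ℝ f z (e, 0) * g z := by
  have hi1 : Integrable (fun z ↦ f z * fderiv ℝ g z (e, (0 : ℝ))) :=
    (hf.continuous.mul ((hg.continuous_fderiv one_ne_zero).clm_apply
      continuous_const)).integrable_of_hasCompactSupport (hc.fderiv_apply ℝ _).mul_left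
  have hi2 : Integrable (fun z ↦ fderiv ℝ f z (e, (0 : ℝ)) * g z) :=
    (((hf.continuous_fderiv one_ne_zero).clm_apply
      continuous_const).mul hg.continuous).integrable_of_hasCompactSupport hc.mul_left
  have hr : (volume : Measure (E × ℝ)).restrict (univ ×ˢ Iic s)
      = (volume : Measure E).prod (volume.restrict (Iic s)) := by
    rw [Measure.volume_eq_prod, ← Measure.prod_restrict, Measure.restrict_univ]
  have hj1 := hi1.integrableOn (s := univ ×ˢ Iic s)
  have hj2 := hi2.integrableOn (s := univ ×ˢ Iic s)
  rw [IntegrableOn, hr] at hj1 hj2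
  rw [hr, integral_prod_symm _ hj1, integral_prod_symm _ hj2, ← integral_neg]
  refine integral_congr_ae (ae_of_all _ fun t ↦ ?_)
  have hf' := contDiff_slice hf t
  have hg' := contDiff_slice hg t
  have hc' := hasCompactSupport_slice_left hc t
  have := integral_mul_fderiv_eq_neg_fderiv_mul_of_integrable (μ := (volume : Measure E))
    (f := fun x ↦ f (x, t)) (g := fun x ↦ g (x, t)) (v := e)
    ((((hf'.continuous_fderiv one_ne_zero).clm_apply
      continuous_const).mul hg'.continuous).integrable_of_hasCompactSupport hc'.mul_left)
    ((hf'.continuous.mul ((hg'.continuous_fderiv one_ne_zero).clm_apply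
      continuous_const)).integrable_of_hasCompactSupport (hc'.fderiv_apply ℝ _).mul_left)
    ((hf'.continuous.mul hg'.continuous).integrable_of_hasCompactSupport hc'.mul_left)
    (fun x _ ↦ hf'.differentiable one_ne_zero x) (fun x _ ↦ hg'.differentiable one_ne_zero x)
  simpa only [fderiv_slice hf, fderiv_slice hg] using this

end Slices


/-! ### Energy estimate for smooth approximate supersolutions -/

/-- A smooth approximate supersolution `w` with flux `B`, below the level `k`: it satisfies
`∂_t w ≥ ∑ i, ∂_i B_i - Θ`, its sublevel set lies in the unit ball, and the flux controls the
gradient up to an integrable error `e`. -/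
structure IsApproxSupersolution {n : ℕ} (w : EuclideanSpace ℝ (Fin n) × ℝ → ℝ)
    (B : Fin n → EuclideanSpace ℝ (Fin n) × ℝ → ℝ) (e : EuclideanSpace ℝ (Fin n) × ℝ → ℝ)
    (k M Θ C₀ : ℝ) : Prop where
  contDiff : ContDiff ℝ 1 w
  contDiff_flux : ∀ i, ContDiff ℝ 1 (B i)
  sublevel : ∀ z, w z < k → z ∈ closedBall (0 : EuclideanSpace ℝ (Fin n) × ℝ) 1
  sub_le : ∀ z, k - w z ≤ M
  pde : ∀ z, w z < k →
    ∑ i, fderiv ℝ (B i) z (EuclideanSpace.single i 1, 0) ≤ fderiv ℝ w z (0, 1) + Θ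
  coercive : ∀ᵐ z, w z < k → ∑ i, |fderiv ℝ w z (EuclideanSpace.single i 1, 0)|
    ≤ ∑ i, B i z * fderiv ℝ w z (EuclideanSpace.single i 1, 0) + C₀ + e z
  error_nonneg : ∀ z, 0 ≤ e z
  integrable_error : Integrable e
  M_nonneg : 0 ≤ M
  Θ_nonneg : 0 ≤ Θ
  C₀_nonneg : 0 ≤ C₀

namespace IsApproxSupersolution

variable {n : ℕ} {w : EuclideanSpace ℝ (Fin n) × ℝ → ℝ}
  {B : Fin n → EuclideanSpace ℝ (Fin n) × ℝ → ℝ} {e : EuclideanSpace ℝ (Fin n) × ℝ → ℝ}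
  {k M Θ C₀ : ℝ}

theorem hasCompactSupport (h : IsApproxSupersolution w B e k M Θ C₀) :
    HasCompactSupport fun z ↦ max (k - w z) 0 :=
  hasCompactSupport_trunc (isCompact_closedBall _ _) h.sublevel

theorem hasCompactSupport_pow (h : IsApproxSupersolution w B e k M Θ C₀) (j : ℕ) :
    HasCompactSupport fun z ↦ max (k - w z) 0 ^ (j + 2) :=
  h.hasCompactSupport.comp_left (g := fun s : ℝ ↦ s ^ (j + 2)) (zero_pow (by omega))

theorem continuous_trunc (h : IsApproxSupersolution w B e k M Θ C₀) :
    Continuous fun z ↦ max (k - w z) 0 :=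
  (continuous_const.sub h.contDiff.continuous).max continuous_const

theorem integrable_trunc (h : IsApproxSupersolution w B e k M Θ C₀) :
    Integrable fun z ↦ max (k - w z) 0 :=
  h.continuous_trunc.integrable_of_hasCompactSupport h.hasCompactSupport

/-- Multiply the differential inequality by `v²`, `v = (k - w)₊`, and integrate up to time `s`. The
time term is `-∂_t(v³)/3`, and integration by parts turns the divergence into `2 v B · Dw`, which
coercivity bounds below by `2 v (∑ |∂_i w| - C₀ - e)`. The bounds `v² ≤ M v` and `v e ≤ M e` leave
only `∬ v` and `∬ e` on the right. -/
theorem energy (h : IsApproxSupersolution w B e k M Θ C₀) (s : ℝ) :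
    (∫ x, max (k - w (x, s)) 0 ^ 3) / 3 + 2 * ∫ z in univ ×ˢ Iic s, max (k - w z) 0 *
        ∑ i, |fderiv ℝ w z (EuclideanSpace.single i 1, 0)|
      ≤ (Θ * M + 2 * C₀) * (∫ z, max (k - w z) 0) + 2 * M * ∫ z, e z := by
  set v : EuclideanSpace ℝ (Fin n) × ℝ → ℝ := fun z ↦ max (k - w z) 0 with hv
  set H : Set (EuclideanSpace ℝ (Fin n) × ℝ) := univ ×ˢ Iic s with hH
  set D : Fin n → EuclideanSpace ℝ (Fin n) × ℝ → ℝ :=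
    fun i z ↦ fderiv ℝ w z (EuclideanSpace.single i 1, 0) with hD
  have hvc : Continuous v := h.continuous_trunc
  have hvs : HasCompactSupport v := h.hasCompactSupport
  have hDc : ∀ i, Continuous (D i) := fun i ↦
    (h.contDiff.continuous_fderiv one_ne_zero).clm_apply continuous_const
  have hBc : ∀ i, Continuous (B i) := fun i ↦ (h.contDiff_flux i).continuous
  have hv0 : ∀ z, 0 ≤ v z := fun z ↦ le_max_right _ _
  have hvM : ∀ z, v z ≤ M := fun z ↦ max_le (h.sub_le z) h.M_nonneg
  have hint : ∀ {f : EuclideanSpace ℝ (Fin n) × ℝ → ℝ}, Continuous f →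
      Integrable (fun z ↦ v z * f z) := fun {f} hf ↦
    (hvc.mul hf).integrable_of_hasCompactSupport hvs.mul_right
  have h2 := contDiff_trunc_pow h.contDiff k 0
  have h3 := contDiff_trunc_pow h.contDiff k 1
  have e2 : ∀ z e, fderiv ℝ (fun z ↦ max (k - w z) 0 ^ (0 + 2)) z e
      = -(2 * v z * fderiv ℝ w z e) := fun z e ↦ by
    rw [fderiv_trunc_pow h.contDiff]; simp [hv]
  have e3 : ∀ z e, fderiv ℝ (fun z ↦ max (k - w z) 0 ^ (1 + 2)) z e
      = -(3 * v z ^ 2 * fderiv ℝ w z e) := fun z e ↦ by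
    rw [fderiv_trunc_pow h.contDiff]; simp only [hv]; norm_num
  have htime := setIntegral_Iic_fderiv_snd h3 (h.hasCompactSupport_pow 1) s
  simp only [e3] at htime
  have hspace : ∀ i, ∫ z in H, v z * (2 * (B i z * D i z))
      = ∫ z in H, v z * (v z * fderiv ℝ (B i) z (EuclideanSpace.single i 1, 0)) := by
    intro i
    have := setIntegral_Iic_mul_fderiv_fst (h.contDiff_flux i) h2 (h.hasCompactSupport_pow 0) s
      (EuclideanSpace.single i 1)
    simp only [e2] at this
    rw [← neg_inj, ← integral_neg]
    convert this using 1
    · exact integral_congr_ae (ae_of_all _ fun z ↦ by simp only [hD]; ring)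
    · exact congrArg _ (integral_congr_ae (ae_of_all _ fun z ↦ by simp only [hv]; ring))
  have hdBc : ∀ i, Continuous fun z ↦ fderiv ℝ (B i) z (EuclideanSpace.single i (1 : ℝ), (0 : ℝ)) :=
    fun i ↦ ((h.contDiff_flux i).continuous_fderiv one_ne_zero).clm_apply continuous_const
  have hdtc : Continuous fun z ↦ fderiv ℝ w z ((0 : EuclideanSpace ℝ (Fin n)), (1 : ℝ)) :=
    (h.contDiff.continuous_fderiv one_ne_zero).clm_apply continuous_const
  have j1 : ∀ i, Integrable fun z ↦ v z * (2 * (B i z * D i z)) := fun i ↦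
    hint (continuous_const.mul ((hBc i).mul (hDc i)))
  have j2 : Integrable fun z ↦ v z * (v z * fderiv ℝ w z (0, 1)) := hint (hvc.mul hdtc)
  have j3 : ∀ c : ℝ, Integrable fun z ↦ v z * c := fun c ↦ hint continuous_const
  have j4 : Integrable fun z ↦ v z * (2 * ∑ i, B i z * D i z) :=
    hint (continuous_const.mul (continuous_finsetSum _ fun i _ ↦ (hBc i).mul (hDc i)))
  have j5 : ∀ i, Integrable fun z ↦
      v z * (v z * fderiv ℝ (B i) z (EuclideanSpace.single i 1, 0)) := fun i ↦
    hint (hvc.mul (hdBc i))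
  have j6 : Integrable fun z ↦ v z * (2 * ∑ i, |D i z|) :=
    hint (continuous_const.mul (continuous_finsetSum _ fun i _ ↦ (hDc i).abs))
  have hle1 : ∫ z in H, v z * (2 * ∑ i, B i z * D i z)
      ≤ ∫ z in H, (v z * (v z * fderiv ℝ w z (0, 1)) + v z * (Θ * M)) := by
    have : ∫ z in H, v z * (2 * ∑ i, B i z * D i z)
        = ∫ z in H, v z * (v z * ∑ i, fderiv ℝ (B i) z (EuclideanSpace.single i 1, 0)) := by
      simp only [Finset.mul_sum]
      rw [integral_finsetSum _ fun i _ ↦ (j1 i).integrableOn,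
        integral_finsetSum _ fun i _ ↦ (j5 i).integrableOn]
      exact Finset.sum_congr rfl fun i _ ↦ hspace i
    rw [this]
    refine integral_mono (hint (hvc.mul (continuous_finsetSum _ fun i _ ↦ hdBc i))).integrableOn
      (j2.add (j3 _)).integrableOn fun z ↦ ?_
    -- The differential inequality is available only where `w < k`; elsewhere `v = 0`.
    rcases lt_or_ge (w z) k with hz | hz
    · have h4 := mul_le_mul_of_nonneg_left (h.pde z hz) (mul_nonneg (hv0 z) (hv0 z))
      have h5 := mul_le_mul_of_nonneg_left (hvM z) (mul_nonneg (hv0 z) h.Θ_nonneg)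
      dsimp only
      nlinarith
    · have : v z = 0 := max_eq_right (by linarith)
      simp [this]
  have hle2 : ∫ z in H, (v z * (v z * fderiv ℝ w z (0, 1)) + v z * (Θ * M))
      = -(∫ x, v (x, s) ^ 3) / 3 + Θ * M * ∫ z in H, v z := by
    rw [integral_add j2.integrableOn (j3 _).integrableOn,
      integral_mul_const, mul_comm (∫ z in H, v z)]
    have : ∫ x, v (x, s) ^ 3 = -3 * ∫ z in H, v z * (v z * fderiv ℝ w z (0, 1)) := by
      rw [← integral_const_mul]
      refine htime.symm.trans (integral_congr_ae (ae_of_all _ fun z ↦ ?_))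
      simp only; ring
    rw [this]; ring
  have hle3 : ∫ z in H, v z * (2 * ∑ i, |D i z|)
      ≤ ∫ z in H, (v z * (2 * ∑ i, B i z * D i z) + v z * (2 * C₀) + 2 * M * e z) := by
    refine integral_mono_ae j6.integrableOn
      ((j4.add (j3 _)).add (h.integrable_error.const_mul _)).integrableOn
      (ae_restrict_of_ae ?_)
    filter_upwards [h.coercive] with z hz
    rcases lt_or_ge (w z) k with hk | hk
    · have h4 := mul_le_mul_of_nonneg_left (hz hk) (hv0 z)
      have h5 := mul_le_mul_of_nonneg_right (hvM z) (h.error_nonneg z)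
      nlinarith
    · have : v z = 0 := max_eq_right (by linarith)
      simp only [this, zero_mul, zero_add]
      exact mul_nonneg (mul_nonneg zero_le_two h.M_nonneg) (h.error_nonneg z)
  have hle4 : ∫ z in H, (v z * (2 * ∑ i, B i z * D i z) + v z * (2 * C₀) + 2 * M * e z)
      = (∫ z in H, v z * (2 * ∑ i, B i z * D i z)) + 2 * C₀ * (∫ z in H, v z)
        + 2 * M * ∫ z in H, e z := by
    have j7 : Integrable fun z ↦ v z * (2 * ∑ i, B i z * D i z) + v z * (2 * C₀) :=
      j4.add (j3 _)
    rw [integral_add j7.integrableOn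
      (h.integrable_error.const_mul _).integrableOn,
      integral_add j4.integrableOn (j3 _).integrableOn, integral_mul_const,
      integral_const_mul, mul_comm (∫ z in H, v z)]
  have hle5 : ∫ z in H, v z ≤ ∫ z, v z :=
    setIntegral_le_integral h.integrable_trunc (ae_of_all _ hv0)
  have hle6 : ∫ z in H, e z ≤ ∫ z, e z :=
    setIntegral_le_integral h.integrable_error (ae_of_all _ h.error_nonneg)
  have hle7 : 2 * ∫ z in H, v z * ∑ i, |D i z| = ∫ z in H, v z * (2 * ∑ i, |D i z|) := by
    rw [← integral_const_mul]
    exact integral_congr_ae (ae_of_all _ fun z ↦ by ring)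
  have := h.M_nonneg
  have := h.Θ_nonneg
  have := h.C₀_nonneg
  have hc1 : (Θ * M + 2 * C₀) * (∫ z in H, v z) ≤ (Θ * M + 2 * C₀) * ∫ z, v z :=
    mul_le_mul_of_nonneg_left hle5 (by positivity)
  have hc2 : 2 * M * (∫ z in H, e z) ≤ 2 * M * ∫ z, e z :=
    mul_le_mul_of_nonneg_left hle6 (by positivity)
  change (∫ x, v (x, s) ^ 3) / 3 + 2 * (∫ z in H, v z * ∑ i, |D i z|) ≤ _
  rw [hle7]
  linarith

end IsApproxSupersolution


/-! ### Parabolic Sobolev inequality -/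

/-- A Gagliardo-Nirenberg inequality interpolating between `W^{1,1}` of `v ^ 2` and `L³` of `v`. -/
theorem exists_lintegral_rpow_le {n : ℕ} (hn : 2 ≤ n) : ∃ K : ℝ≥0,
    ∀ v : EuclideanSpace ℝ (Fin n) → ℝ, (∀ x, 0 ≤ v x) → Continuous v →
      ContDiff ℝ 1 (fun x ↦ v x ^ 2) → HasCompactSupport (fun x ↦ v x ^ 2) →
      ∫⁻ x, ENNReal.ofReal (v x) ^ (2 + 3 / n : ℝ)
        ≤ K * (∫⁻ x, ‖fderiv ℝ (fun x ↦ v x ^ 2) x‖ₑ)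
          * (∫⁻ x, ENNReal.ofReal (v x ^ 3)) ^ (1 / n : ℝ) := by
  have hn0 : (0 : ℝ) < n := by exact_mod_cast (by omega : 0 < n)
  have hc : Real.HolderConjugate (n : ℝ) (Real.conjExponent n) :=
    Real.HolderConjugate.conjExponent (by exact_mod_cast (by omega : 1 < n))
  set q : ℝ := Real.conjExponent n
  have hq : 0 < q := hc.symm.pos
  refine ⟨lintegralPowLePowLIntegralFDerivConst
    (volume : Measure (EuclideanSpace ℝ (Fin n))) q ^ (1 / q), fun v hv0 hvc hv1 hvs ↦ ?_⟩
  have hgns := lintegral_pow_le_pow_lintegral_fderiv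
    (volume : Measure (EuclideanSpace ℝ (Fin n))) hv1 hvs (p := q) (by simpa using hc)
  have hm1 : Measurable fun x ↦ ‖v x ^ 2‖ₑ := (hvc.pow 2).measurable.enorm
  have hm2 : Measurable fun x ↦ ENNReal.ofReal (v x) ^ (3 / n : ℝ) :=
    hvc.measurable.ennreal_ofReal.pow_const _
  -- Hölder for `v² · v^{3/n}` with exponents `n/(n-1)` and `n`; the first factor is then controlled
  -- by the Sobolev inequality applied to `v²`.
  calc ∫⁻ x, ENNReal.ofReal (v x) ^ (2 + 3 / n : ℝ)
      = ∫⁻ x, ((fun x ↦ ‖v x ^ 2‖ₑ) * fun x ↦ ENNReal.ofReal (v x) ^ (3 / n : ℝ)) x := by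
        refine lintegral_congr fun x ↦ ?_
        rw [Pi.mul_apply, ENNReal.rpow_add_of_nonneg _ _ zero_le_two (by positivity),
          Real.enorm_eq_ofReal (by positivity), ENNReal.ofReal_pow (hv0 x), ENNReal.rpow_two]
    _ ≤ (∫⁻ x, ‖v x ^ 2‖ₑ ^ q) ^ (1 / q)
        * (∫⁻ x, (ENNReal.ofReal (v x) ^ (3 / n : ℝ)) ^ (n : ℝ)) ^ (1 / n : ℝ) :=
        ENNReal.lintegral_mul_le_Lp_mul_Lq _ hc.symm hm1.aemeasurable hm2.aemeasurable
    _ ≤ _ := by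
        refine mul_le_mul' ?_ (le_of_eq ?_)
        · refine (ENNReal.rpow_le_rpow hgns (by positivity)).trans_eq ?_
          rw [ENNReal.mul_rpow_of_nonneg _ _ (by positivity), ← ENNReal.rpow_mul,
            mul_one_div_cancel hq.ne', ENNReal.rpow_one, ENNReal.coe_rpow_of_nonneg _ (by positivity)]
        · congr 1
          refine lintegral_congr fun x ↦ ?_
          rw [← ENNReal.rpow_mul, div_mul_cancel₀ _ hn0.ne', ENNReal.ofReal_pow (hv0 x)]
          norm_cast

namespace IsApproxSupersolution

/-- The slice inequality is integrated in time. Both of its factors are bounded by the energy `S`: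
the gradient term after integration, the cubic one uniformly in time and with power `1/n`. This
gives the total power `1 + 1/n`, which is the gain driving the iteration. -/
theorem exists_integral_rpow_le {n : ℕ} (hn : 2 ≤ n) : ∃ K : ℝ, 0 ≤ K ∧
    ∀ {w : EuclideanSpace ℝ (Fin n) × ℝ → ℝ} {B : Fin n → EuclideanSpace ℝ (Fin n) × ℝ → ℝ}
      {e : EuclideanSpace ℝ (Fin n) × ℝ → ℝ} {k M Θ C₀ : ℝ},
      IsApproxSupersolution w B e k M Θ C₀ →
      ∫ z, max (k - w z) 0 ^ (2 + 3 / n : ℝ)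
        ≤ K * ((Θ * M + 2 * C₀) * (∫ z, max (k - w z) 0) + 2 * M * ∫ z, e z) ^ (1 + 1 / n : ℝ) := by
  obtain ⟨K, hK⟩ := exists_lintegral_rpow_le hn
  refine ⟨K * 3 ^ (1 / n : ℝ), by positivity, fun {w B e k M Θ C₀} h ↦ ?_⟩
  set v : EuclideanSpace ℝ (Fin n) × ℝ → ℝ := fun z ↦ max (k - w z) 0 with hv
  set S : ℝ := (Θ * M + 2 * C₀) * (∫ z, v z) + 2 * M * ∫ z, e z with hS
  have hv0 : ∀ z, 0 ≤ v z := fun z ↦ le_max_right _ _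
  have hvc : Continuous v := h.continuous_trunc
  have hvs : HasCompactSupport v := h.hasCompactSupport
  have h2 := contDiff_trunc_pow h.contDiff k 0
  have hDc : ∀ i : Fin n, Continuous fun z ↦ fderiv ℝ w z (EuclideanSpace.single i 1, 0) := fun i ↦
    (h.contDiff.continuous_fderiv one_ne_zero).clm_apply continuous_const
  have hgc : Continuous fun z ↦ v z * ∑ i : Fin n,
      |fderiv ℝ w z (EuclideanSpace.single i 1, 0)| :=
    hvc.mul (continuous_finsetSum _ fun i _ ↦ (hDc i).abs)
  have hgi : Integrable fun z ↦ v z * ∑ i : Fin n,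
      |fderiv ℝ w z (EuclideanSpace.single i 1, 0)| := hgc.integrable_of_hasCompactSupport hvs.mul_right
  have hg0 : ∀ z, 0 ≤ v z * ∑ i : Fin n, |fderiv ℝ w z (EuclideanSpace.single i 1, 0)| := fun z ↦
    mul_nonneg (hv0 z) (Finset.sum_nonneg fun i _ ↦ abs_nonneg _)
  have hgS : 2 * ∫ z, v z * ∑ i : Fin n, |fderiv ℝ w z (EuclideanSpace.single i 1, 0)| ≤ S := by
    -- Time `1` suffices: `{w < k}` lies in the unit ball, so nothing is lost by integrating over `t
    -- ≤ 1` only.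
    have h1 := h.energy 1
    rw [setIntegral_eq_integral_of_forall_compl_eq_zero] at h1
    · have : 0 ≤ ∫ x, max (k - w (x, 1)) 0 ^ 3 :=
        integral_nonneg fun x ↦ pow_nonneg (le_max_right _ _) _
      simp only [hv, hS]
      linarith
    · intro z hz
      rw [mul_eq_zero]
      left
      refine max_eq_right (sub_nonpos.2 (le_of_not_gt fun hlt ↦ hz ⟨mem_univ _, ?_⟩))
      have := h.sublevel z hlt
      rw [mem_closedBall_zero_iff] at this
      exact (le_abs_self _).trans ((norm_snd_le z).trans this)
  have hS0 : 0 ≤ S := le_trans (mul_nonneg zero_le_two (integral_nonneg hg0)) hgS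
  have hcube : ∀ t, ∫⁻ x, ENNReal.ofReal (v (x, t) ^ 3) ≤ ENNReal.ofReal (3 * S) := by
    intro t
    have hc3 : Integrable fun x ↦ v (x, t) ^ 3 :=
      (contDiff_slice (contDiff_trunc_pow h.contDiff k 1) t).continuous.integrable_of_hasCompactSupport
        (hasCompactSupport_slice_left (h.hasCompactSupport_pow 1) t)
    rw [← ofReal_integral_eq_lintegral_ofReal hc3 (ae_of_all _ fun x ↦ pow_nonneg (hv0 _) _)]
    refine ENNReal.ofReal_le_ofReal ?_
    have h1 := h.energy t
    have : 0 ≤ ∫ z in univ ×ˢ Iic t, v z *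
      ∑ i : Fin n, |fderiv ℝ w z (EuclideanSpace.single i 1, 0)| := integral_nonneg fun z ↦ hg0 z
    simp only [hv, hS] at this ⊢
    linarith
  have hgrad : ∀ t, ∫⁻ x, ‖fderiv ℝ (fun x ↦ v (x, t) ^ 2) x‖ₑ ≤ ∫⁻ x, ENNReal.ofReal
      (2 * (v (x, t) * ∑ i : Fin n, |fderiv ℝ w (x, t) (EuclideanSpace.single i 1, 0)|)) := by
    refine fun t ↦ lintegral_mono fun x ↦ ?_
    rw [← ofReal_norm]
    refine ENNReal.ofReal_le_ofReal ((norm_le_sum_abs_single _).trans_eq ?_)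
    rw [Finset.mul_sum, Finset.mul_sum]
    refine Finset.sum_congr rfl fun i _ ↦ ?_
    rw [fderiv_slice (f := fun z ↦ v z ^ 2) h2, fderiv_trunc_pow h.contDiff, abs_neg, abs_mul,
      abs_mul, abs_of_nonneg (pow_nonneg (hv0 (x, t)) _)]
    simp [hv, mul_assoc]
  have hmain : ∫⁻ z, ENNReal.ofReal (v z ^ (2 + 3 / n : ℝ))
      ≤ ENNReal.ofReal (K * 3 ^ (1 / n : ℝ) * S ^ (1 + 1 / n : ℝ)) := by
    have hmv : Measurable fun z ↦ ENNReal.ofReal (v z ^ (2 + 3 / n : ℝ)) :=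
      (hvc.measurable.pow_const _).ennreal_ofReal
    have hmg := (continuous_const.mul hgc).measurable.ennreal_ofReal (α := EuclideanSpace ℝ (Fin n) × ℝ)
      (f := fun z ↦ (2 : ℝ) * (v z * ∑ i : Fin n, |fderiv ℝ w z (EuclideanSpace.single i 1, 0)|))
    calc ∫⁻ z, ENNReal.ofReal (v z ^ (2 + 3 / n : ℝ))
        = ∫⁻ t, ∫⁻ x, ENNReal.ofReal (v (x, t) ^ (2 + 3 / n : ℝ)) := by
          rw [Measure.volume_eq_prod, lintegral_prod_symm' _ hmv]
      _ ≤ ∫⁻ t, (K * ENNReal.ofReal (3 * S) ^ (1 / n : ℝ)) * ∫⁻ x, ENNReal.ofReal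
            (2 * (v (x, t) * ∑ i : Fin n, |fderiv ℝ w (x, t) (EuclideanSpace.single i 1, 0)|)) := by
          refine lintegral_mono fun t ↦ ?_
          have := hK (fun x ↦ v (x, t)) (fun x ↦ hv0 _) (by fun_prop)
            (contDiff_slice h2 t) (hasCompactSupport_slice_left (h.hasCompactSupport_pow 0) t)
          simp_rw [← ENNReal.ofReal_rpow_of_nonneg (hv0 _)
            (show (0 : ℝ) ≤ 2 + 3 / n by positivity)]
          refine this.trans ?_
          rw [mul_right_comm]
          exact mul_le_mul' (mul_le_mul' le_rfl
            (ENNReal.rpow_le_rpow (hcube t) (by positivity))) (hgrad t)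
      _ = (K * ENNReal.ofReal (3 * S) ^ (1 / n : ℝ)) * ∫⁻ z, ENNReal.ofReal
            (2 * (v z * ∑ i : Fin n, |fderiv ℝ w z (EuclideanSpace.single i 1, 0)|)) := by
          rw [Measure.volume_eq_prod, lintegral_prod_symm' _ hmg,
            lintegral_const_mul _ hmg.lintegral_prod_left']
      _ ≤ (K * ENNReal.ofReal (3 * S) ^ (1 / n : ℝ)) * ENNReal.ofReal S := by
          gcongr
          rw [← ofReal_integral_eq_lintegral_ofReal (hgi.const_mul 2)
            (ae_of_all _ fun z ↦ mul_nonneg zero_le_two (hg0 z)), integral_const_mul]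
          exact ENNReal.ofReal_le_ofReal hgS
      _ = _ := by
          rw [ENNReal.ofReal_rpow_of_nonneg (by positivity) (by positivity),
            ← ENNReal.ofReal_coe_nnreal, ← ENNReal.ofReal_mul (by positivity),
            ← ENNReal.ofReal_mul (by positivity), Real.mul_rpow (by norm_num) hS0,
            Real.rpow_add_of_nonneg hS0 zero_le_one (by positivity), Real.rpow_one]
          congr 1
          ring
  have hnn : ∀ z, 0 ≤ v z ^ (2 + 3 / n : ℝ) := fun z ↦ Real.rpow_nonneg (hv0 z) _
  rw [integral_eq_lintegral_of_nonneg_ae (ae_of_all _ hnn)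
    (hvc.measurable.pow_const _).aestronglyMeasurable]
  exact ENNReal.toReal_le_of_le_ofReal (by positivity) hmain

end IsApproxSupersolution


/-! ### `L¹` limits of mollified functions and products -/

section MollificationLimits

theorem tendsto_integral_abs_of_eLpNorm {G : Type*} [MeasurableSpace G] {μ : Measure G}
    {f : ℕ → G → ℝ}
    (h : Tendsto (fun j ↦ eLpNorm (f j) 1 μ) atTop (𝓝 0))
    (hm : ∀ j, AEStronglyMeasurable (f j) μ) :
    Tendsto (fun j ↦ ∫ x, |f j x| ∂μ) atTop (𝓝 0) := by
  have := (ENNReal.tendsto_toReal ENNReal.zero_ne_top).comp h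
  refine this.congr fun j ↦ ?_
  simp only [Function.comp_apply, eLpNorm_one_eq_lintegral_enorm, ← Real.norm_eq_abs]
  exact (integral_norm_eq_lintegral_enorm (hm j)).symm

variable {G : Type*} [NormedAddCommGroup G] [NormedSpace ℝ G] [FiniteDimensional ℝ G]
  [MeasurableSpace G] [BorelSpace G] {μ : Measure G} [μ.IsAddHaarMeasure]

theorem integrable_mollify (φ : ContDiffBump (0 : G)) {f : G → ℝ} (hf : Integrable f μ) :
    Integrable (mollify μ φ f) μ :=
  φ.integrable_normed.integrable_convolution _ hf

theorem tendsto_integral_abs_mollify_sub {f : G → ℝ} (hf : Integrable f μ)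
    {φ : ℕ → ContDiffBump (0 : G)} (hφ : Tendsto (fun j ↦ (φ j).rOut) atTop (𝓝 0)) :
    Tendsto (fun j ↦ ∫ x, |mollify μ (φ j) f x - f x| ∂μ) atTop (𝓝 0) := by
  have := tendsto_eLpNorm_mollify_sub (μ := μ) le_rfl (f := f) (by simpa [memLp_one_iff_integrable]) hφ
  rw [ENNReal.ofReal_one] at this
  exact tendsto_integral_abs_of_eLpNorm this fun j ↦ ((integrable_mollify _ hf).sub hf).1

theorem memLp_mollify (φ : ContDiffBump (0 : G)) {f : G → ℝ} {p : ℝ} (hp : 1 ≤ p)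
    (hf : MemLp f (ENNReal.ofReal p) μ) : MemLp (mollify μ φ f) (ENNReal.ofReal p) μ :=
  ⟨(contDiff_mollify φ (hf.locallyIntegrable (by simpa))).continuous.aestronglyMeasurable,
    (eLpNorm_mollify_le φ hp hf.1).trans_lt hf.2⟩

theorem integrable_mollify_mul_mollify (φ : ContDiffBump (0 : G)) {f g : G → ℝ} {p q : ℝ}
    (hpq : p.HolderConjugate q) (hf : MemLp f (ENNReal.ofReal p) μ)
    (hg : MemLp g (ENNReal.ofReal q) μ) :
    Integrable (fun x ↦ mollify μ φ f x * mollify μ φ g x) μ := by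
  have := hpq.ennrealOfReal
  exact (memLp_mollify φ hpq.lt.le hf).integrable_mul (memLp_mollify φ hpq.symm.lt.le hg)

/-- Used for the product of flux and gradient, whose exponents are conjugate: Hölder applied to `f_j
(g_j - g) + (f_j - f) g`, together with the contraction property. -/
theorem tendsto_integral_abs_mollify_mul_sub {f g : G → ℝ} {p q : ℝ}
    (hpq : p.HolderConjugate q) (hf : MemLp f (ENNReal.ofReal p) μ)
    (hg : MemLp g (ENNReal.ofReal q) μ)
    {φ : ℕ → ContDiffBump (0 : G)} (hφ : Tendsto (fun j ↦ (φ j).rOut) atTop (𝓝 0)) :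
    Tendsto (fun j ↦ ∫ x, |mollify μ (φ j) f x * mollify μ (φ j) g x - f x * g x| ∂μ)
      atTop (𝓝 0) := by
  have := hpq.ennrealOfReal
  have hp := hpq.lt.le
  have hq := hpq.symm.lt.le
  have hfm : ∀ j, AEStronglyMeasurable (mollify μ (φ j) f) μ :=
    fun j ↦ (memLp_mollify (φ j) hp hf).1
  have hgm : ∀ j, AEStronglyMeasurable (mollify μ (φ j) g) μ :=
    fun j ↦ (memLp_mollify (φ j) hq hg).1
  refine tendsto_integral_abs_of_eLpNorm (f := fun j x ↦
    mollify μ (φ j) f x * mollify μ (φ j) g x - f x * g x)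
    ?_ fun j ↦ ((hfm j).mul (hgm j)).sub (hf.1.mul hg.1)
  have h1 := tendsto_eLpNorm_mollify_sub hp hf hφ
  have h2 := tendsto_eLpNorm_mollify_sub hq hg hφ
  have h3 : Tendsto (fun j ↦ eLpNorm f (ENNReal.ofReal p) μ
        * eLpNorm (mollify μ (φ j) g - g) (ENNReal.ofReal q) μ
      + eLpNorm (mollify μ (φ j) f - f) (ENNReal.ofReal p) μ
        * eLpNorm g (ENNReal.ofReal q) μ) atTop (𝓝 0) := by
    simpa using (ENNReal.Tendsto.const_mul h2 (Or.inr hf.2.ne)).add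
      (ENNReal.Tendsto.mul_const h1 (Or.inr hg.2.ne))
  refine tendsto_of_tendsto_of_tendsto_of_le_of_le tendsto_const_nhds h3 (fun _ ↦ zero_le) fun j ↦ ?_
  have hsplit : (fun x ↦ mollify μ (φ j) f x * mollify μ (φ j) g x
        - f x * g x)
      = mollify μ (φ j) f • (mollify μ (φ j) g - g)
        + (mollify μ (φ j) f - f) • g := by
    ext x
    simp only [Pi.add_apply, Pi.mul_apply, Pi.sub_apply, smul_eq_mul]
    ring
  dsimp only
  rw [hsplit]
  refine (eLpNorm_add_le ((hfm j).smul ((hgm j).sub hg.1)) (((hfm j).sub hf.1).smul hg.1)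
    le_rfl).trans (add_le_add ?_ ?_)
  · refine (eLpNorm_smul_le_mul_eLpNorm (p := ENNReal.ofReal p) (q := ENNReal.ofReal q)
      ((hgm j).sub hg.1) (hfm j)).trans ?_
    exact mul_le_mul' (eLpNorm_mollify_le _ hp hf.1) le_rfl
  · exact eLpNorm_smul_le_mul_eLpNorm (p := ENNReal.ofReal p) (q := ENNReal.ofReal q)
      hg.1 ((hfm j).sub hf.1)

end MollificationLimits

/-! ### Supersolutions on the ball, the paraboloid and mollification -/

/-- A weak supersolution `U` on the ball of radius `2` in space-time, with spatial gradient `G` and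
flux `B`, all extended to the whole space, which is bounded below by `m` and whose flux controls
its gradient. -/
structure IsBallSupersolution {n : ℕ} (p : Fin n → ℝ) (U : EuclideanSpace ℝ (Fin n) × ℝ → ℝ)
    (G B : Fin n → EuclideanSpace ℝ (Fin n) × ℝ → ℝ) (m M C₀ : ℝ) : Prop where
  integrable : Integrable U
  integrable_grad : ∀ i, Integrable (G i)
  integrable_flux : ∀ i, Integrable (B i)
  memLp_grad : ∀ i, MemLp (G i) (ENNReal.ofReal (p i))
  memLp_flux : ∀ i, MemLp (B i) (ENNReal.ofReal (p i).conjExponent)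
  integral_le : ∀ φ : EuclideanSpace ℝ (Fin n) × ℝ → ℝ, IsTestFunction (ball 0 2) φ →
    (∀ z, 0 ≤ φ z) → ∫ z, (U z * fderiv ℝ φ z (0, 1)
      - ∑ i, B i z * fderiv ℝ φ z (EuclideanSpace.single i 1, 0)) ≤ 0
  integral_eq : ∀ i, ∀ φ : EuclideanSpace ℝ (Fin n) × ℝ → ℝ, IsTestFunction (ball 0 2) φ →
    ∫ z, U z * fderiv ℝ φ z (EuclideanSpace.single i 1, 0) = -∫ z, G i z * φ z
  lower : ∀ᵐ z, m ≤ U z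
  coercive : ∀ᵐ z, ∀ i, |G i z| + 2 * M * |B i z| ≤ B i z * G i z + C₀

/-- The paraboloid `(x, t) ↦ |x|² + t²`. -/
noncomputable def paraboloid {n : ℕ} (z : EuclideanSpace ℝ (Fin n) × ℝ) : ℝ := ‖z.1‖ ^ 2 + z.2 ^ 2

section Paraboloid

variable {n : ℕ}

theorem contDiff_paraboloid : ContDiff ℝ 1 (paraboloid (n := n)) :=
  ((contDiff_norm_sq ℝ).comp contDiff_fst).add (contDiff_snd.pow 2)

theorem paraboloid_nonneg (z : EuclideanSpace ℝ (Fin n) × ℝ) : 0 ≤ paraboloid z := by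
  unfold paraboloid; positivity

theorem fderiv_paraboloid (z y : EuclideanSpace ℝ (Fin n) × ℝ) :
    fderiv ℝ paraboloid z y = 2 * inner ℝ z.1 y.1 + 2 * z.2 * y.2 := by
  have h1 : HasFDerivAt (fun z : EuclideanSpace ℝ (Fin n) × ℝ ↦ ‖z.1‖ ^ 2) _ z :=
    (hasFDerivAt_fst (𝕜 := ℝ) (p := z)).norm_sq
  have h2 : HasFDerivAt (fun z : EuclideanSpace ℝ (Fin n) × ℝ ↦ z.2 ^ 2) _ z :=
    (hasFDerivAt_snd (𝕜 := ℝ) (p := z)).pow 2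
  rw [HasFDerivAt.fderiv (f := paraboloid) (h1.add h2)]
  simp

theorem mem_closedBall_of_paraboloid_lt {z : EuclideanSpace ℝ (Fin n) × ℝ} (h : paraboloid z < 1) :
    z ∈ closedBall (0 : EuclideanSpace ℝ (Fin n) × ℝ) 1 := by
  unfold paraboloid at h
  rw [mem_closedBall_zero_iff, Prod.norm_def, max_le_iff, Real.norm_eq_abs]
  constructor
  · nlinarith [sq_nonneg z.2, norm_nonneg z.1]
  · rw [abs_le]
    constructor <;> nlinarith [sq_nonneg ‖z.1‖]

theorem abs_fderiv_paraboloid_single {z : EuclideanSpace ℝ (Fin n) × ℝ}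
    (h : z ∈ closedBall (0 : EuclideanSpace ℝ (Fin n) × ℝ) 1) (i : Fin n) :
    |fderiv ℝ paraboloid z (EuclideanSpace.single i 1, 0)| ≤ 2 := by
  rw [mem_closedBall_zero_iff] at h
  rw [fderiv_paraboloid]
  have h1 : |z.1 i| ≤ 1 := (PiLp.norm_apply_le z.1 i).trans ((norm_fst_le z).trans h)
  simpa [EuclideanSpace.inner_single_right, abs_mul] using h1

theorem fderiv_paraboloid_time_ge {z : EuclideanSpace ℝ (Fin n) × ℝ}
    (h : z ∈ closedBall (0 : EuclideanSpace ℝ (Fin n) × ℝ) 1) :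
    -2 ≤ fderiv ℝ paraboloid z (0, 1) := by
  rw [mem_closedBall_zero_iff] at h
  rw [fderiv_paraboloid]
  have h1 := (abs_le.1 ((norm_snd_le z).trans h)).1
  simp only [inner_zero_right]
  linarith

end Paraboloid


section Mollified

variable {n : ℕ}

instance isAddHaarMeasure_volume_prod_real :
    (volume : Measure (EuclideanSpace ℝ (Fin n) × ℝ)).IsAddHaarMeasure :=
  inferInstanceAs ((volume : Measure (EuclideanSpace ℝ (Fin n))).prod
    (volume : Measure ℝ)).IsAddHaarMeasure

/-- The function `y ↦ η (x - y)`, for a normalized bump function `η` supported near `0`, is a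
nonnegative test function on the ball of radius `2` when `x` lies in the unit ball. -/
theorem isTestFunction_normed_sub {X : Type*} [NormedAddCommGroup X] [NormedSpace ℝ X]
    [FiniteDimensional ℝ X] [MeasurableSpace X] [BorelSpace X] {μ : Measure X} [μ.IsAddHaarMeasure]
    (φ : ContDiffBump (0 : X)) (hφ : φ.rOut < 1) {x : X} (hx : x ∈ closedBall (0 : X) 1) :
    IsTestFunction (ball 0 2) fun y ↦ φ.normed μ (x - y) where
  smooth := φ.contDiff_normed.comp (contDiff_const.sub contDiff_id)
  compact_support := φ.hasCompactSupport_normed.comp_homeomorph (Homeomorph.subLeft x)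
  support_subset := by
    have h : tsupport (fun y ↦ φ.normed μ (x - y)) ⊆ closedBall x φ.rOut := by
      refine closure_minimal (fun y hy ↦ ?_) isClosed_closedBall
      have : x - y ∈ ball (0 : X) φ.rOut := φ.support_normed_eq (μ := μ) ▸ hy
      rw [mem_ball_zero_iff] at this
      rw [mem_closedBall, dist_comm, dist_eq_norm]
      exact this.le
    refine h.trans fun y hy ↦ ?_
    rw [mem_ball]
    calc dist y 0 ≤ dist y x + dist x 0 := dist_triangle _ _ _
      _ < 2 := by
        have h1 := mem_closedBall.1 hy
        have h2 := mem_closedBall.1 hx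
        linarith

theorem fderiv_normed_sub {X : Type*} [NormedAddCommGroup X] [NormedSpace ℝ X]
    [FiniteDimensional ℝ X] [MeasurableSpace X] [BorelSpace X] {μ : Measure X} [μ.IsAddHaarMeasure]
    (φ : ContDiffBump (0 : X)) (x y e : X) :
    fderiv ℝ (fun y ↦ φ.normed μ (x - y)) y e = -fderiv ℝ (φ.normed μ) (x - y) e := by
  have h1 : HasFDerivAt (φ.normed μ) _ (x - y) :=
    ((φ.contDiff_normed (n := 1)).differentiable one_ne_zero (x - y)).hasFDerivAt
  have h2 := HasFDerivAt.comp y h1 ((hasFDerivAt_id (𝕜 := ℝ) y).const_sub x)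
  rw [HasFDerivAt.fderiv (f := fun y ↦ φ.normed μ (x - y)) h2]
  simp

namespace IsBallSupersolution

variable {p : Fin n → ℝ} {U : EuclideanSpace ℝ (Fin n) × ℝ → ℝ}
  {G B : Fin n → EuclideanSpace ℝ (Fin n) × ℝ → ℝ} {m M C₀ : ℝ}

/-- The reflected kernel `y ↦ η (z - y)` is an admissible test function, because `z` is in the unit
ball and `η` is supported within distance less than `1`. The same choice gives the differential
inequality in `sum_fderiv_mollify_le`. -/
theorem fderiv_mollify_eq (h : IsBallSupersolution p U G B m M C₀)
    {φ : ContDiffBump (0 : EuclideanSpace ℝ (Fin n) × ℝ)} (hφ : φ.rOut < 1)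
    {z : EuclideanSpace ℝ (Fin n) × ℝ} (hz : z ∈ closedBall (0 : EuclideanSpace ℝ (Fin n) × ℝ) 1)
    (i : Fin n) :
    fderiv ℝ (mollify volume φ U) z (EuclideanSpace.single i 1, 0)
      = mollify volume φ (G i) z := by
  have h1 := h.integral_eq i _ (isTestFunction_normed_sub (μ := volume) φ hφ hz)
  rw [fderiv_mollify _ h.integrable.locallyIntegrable, mollify_apply]
  simp only [fderiv_normed_sub, mul_neg, integral_neg, neg_inj] at h1
  simpa only [mul_comm] using h1

theorem sum_fderiv_mollify_le (h : IsBallSupersolution p U G B m M C₀)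
    {φ : ContDiffBump (0 : EuclideanSpace ℝ (Fin n) × ℝ)} (hφ : φ.rOut < 1)
    {z : EuclideanSpace ℝ (Fin n) × ℝ} (hz : z ∈ closedBall (0 : EuclideanSpace ℝ (Fin n) × ℝ) 1) :
    ∑ i, fderiv ℝ (mollify volume φ (B i)) z (EuclideanSpace.single i 1, 0)
      ≤ fderiv ℝ (mollify volume φ U) z (0, 1) := by
  have h1 := h.integral_le _ (isTestFunction_normed_sub (μ := volume) φ hφ hz)
    fun y ↦ φ.nonneg_normed _
  simp only [fderiv_mollify _ h.integrable.locallyIntegrable,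
    fderiv_mollify _ (h.integrable_flux _).locallyIntegrable]
  have hd : ∀ e, ∃ C, ∀ y, ‖fderiv ℝ (φ.normed volume) (z - y) e‖ ≤ C := fun e ↦ by
    obtain ⟨C, hC⟩ := ((φ.hasCompactSupport_normed (μ := volume)).fderiv_apply ℝ
      e).exists_bound_of_continuous
      (((φ.contDiff_normed (n := 1)).continuous_fderiv one_ne_zero).clm_apply continuous_const)
    exact ⟨C, fun y ↦ hC _⟩
  have hi : ∀ {f : EuclideanSpace ℝ (Fin n) × ℝ → ℝ}, Integrable f → ∀ e,
      Integrable fun y ↦ f y * fderiv ℝ (φ.normed volume) (z - y) e := fun {f} hf e ↦ by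
    obtain ⟨C, hC⟩ := hd e
    refine hf.mul_bdd (c := C) ?_ (ae_of_all _ hC)
    exact ((((φ.contDiff_normed (n := 1)).continuous_fderiv one_ne_zero).comp
      (continuous_const.sub continuous_id)).clm_apply continuous_const).aestronglyMeasurable
  simp only [fderiv_normed_sub, mul_neg, Finset.sum_neg_distrib, sub_neg_eq_add] at h1
  have hineg : Integrable fun y ↦ -(U y * fderiv ℝ (φ.normed volume) (z - y) (0, 1)) :=
    (hi h.integrable _).neg
  rw [integral_add hineg
    (integrable_finsetSum _ fun i _ ↦ hi (h.integrable_flux i) _), integral_neg,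
    integral_finsetSum _ fun i _ ↦ hi (h.integrable_flux i) _] at h1
  simp only [mul_comm (fderiv ℝ (φ.normed volume) _ _)]
  linarith

/-- The error committed in the coercivity inequality by mollification. -/
noncomputable def mollificationError (G B : Fin n → EuclideanSpace ℝ (Fin n) × ℝ → ℝ) (M : ℝ)
    (φ : ContDiffBump (0 : EuclideanSpace ℝ (Fin n) × ℝ)) (z : EuclideanSpace ℝ (Fin n) × ℝ) : ℝ :=
  ∑ i, (|mollify volume φ (G i) z - G i z|
    + |mollify volume φ (B i) z * mollify volume φ (G i) z - B i z * G i z|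
    + 2 * M * |mollify volume φ (B i) z - B i z|)

theorem integrable_flux_mul_grad (h : IsBallSupersolution p U G B m M C₀) (hp : ∀ i, 1 < p i)
    (i : Fin n) : Integrable fun z ↦ B i z * G i z := by
  have := (Real.HolderConjugate.conjExponent (hp i)).symm.ennrealOfReal
  exact (h.memLp_flux i).integrable_mul (h.memLp_grad i)

theorem integrable_errorTerm₁ (h : IsBallSupersolution p U G B m M C₀)
    (φ : ContDiffBump (0 : EuclideanSpace ℝ (Fin n) × ℝ)) (i : Fin n) :
    Integrable fun z ↦ |mollify volume φ (G i) z - G i z| :=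
  ((integrable_mollify φ (h.integrable_grad i)).sub (h.integrable_grad i)).abs

theorem integrable_errorTerm₂ (h : IsBallSupersolution p U G B m M C₀) (hp : ∀ i, 1 < p i)
    (φ : ContDiffBump (0 : EuclideanSpace ℝ (Fin n) × ℝ)) (i : Fin n) : Integrable fun z ↦
      |mollify volume φ (B i) z * mollify volume φ (G i) z - B i z * G i z| :=
  ((integrable_mollify_mul_mollify φ (Real.HolderConjugate.conjExponent (hp i)).symm
    (h.memLp_flux i) (h.memLp_grad i)).sub (h.integrable_flux_mul_grad hp i)).abs

theorem integrable_errorTerm₃ (h : IsBallSupersolution p U G B m M C₀)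
    (φ : ContDiffBump (0 : EuclideanSpace ℝ (Fin n) × ℝ)) (i : Fin n) :
    Integrable fun z ↦ 2 * M * |mollify volume φ (B i) z - B i z| :=
  ((integrable_mollify φ (h.integrable_flux i)).sub (h.integrable_flux i)).abs.const_mul _

theorem integrable_mollificationError (h : IsBallSupersolution p U G B m M C₀)
    (hp : ∀ i, 1 < p i) (φ : ContDiffBump (0 : EuclideanSpace ℝ (Fin n) × ℝ)) :
    Integrable (mollificationError G B M φ) :=
  integrable_finsetSum _ fun i _ ↦ ((h.integrable_errorTerm₁ φ i).add
    (h.integrable_errorTerm₂ hp φ i)).add (h.integrable_errorTerm₃ φ i)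

theorem tendsto_integral_mollificationError (h : IsBallSupersolution p U G B m M C₀)
    (hp : ∀ i, 1 < p i) {φ : ℕ → ContDiffBump (0 : EuclideanSpace ℝ (Fin n) × ℝ)}
    (hφ : Tendsto (fun j ↦ (φ j).rOut) atTop (𝓝 0)) :
    Tendsto (fun j ↦ ∫ z, mollificationError G B M (φ j) z) atTop (𝓝 0) := by
  have h1 := fun i ↦ tendsto_integral_abs_mollify_sub (h.integrable_grad i) hφ
  have h2 := fun i ↦ tendsto_integral_abs_mollify_mul_sub
    (Real.HolderConjugate.conjExponent (hp i)).symm (h.memLp_flux i) (h.memLp_grad i) hφ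
  have h3 := fun i ↦ (tendsto_integral_abs_mollify_sub (h.integrable_flux i) hφ).const_mul (2 * M)
  have h4 := tendsto_finsetSum Finset.univ fun i _ ↦ ((h1 i).add (h2 i)).add (h3 i)
  simp only [mul_zero, add_zero, Finset.sum_const_zero] at h4
  refine h4.congr fun j ↦ ?_
  have h12 : ∀ i, Integrable fun z ↦ |mollify volume (φ j) (G i) z - G i z|
      + |mollify volume (φ j) (B i) z * mollify volume (φ j) (G i) z - B i z * G i z| := fun i ↦
    (h.integrable_errorTerm₁ (φ j) i).add (h.integrable_errorTerm₂ hp (φ j) i)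
  have h123 : ∀ i, Integrable fun z ↦ |mollify volume (φ j) (G i) z - G i z|
      + |mollify volume (φ j) (B i) z * mollify volume (φ j) (G i) z - B i z * G i z|
      + 2 * M * |mollify volume (φ j) (B i) z - B i z| := fun i ↦
    (h12 i).add (h.integrable_errorTerm₃ (φ j) i)
  unfold mollificationError
  rw [integral_finsetSum _ fun i _ ↦ h123 i]
  refine Finset.sum_congr rfl fun i _ ↦ ?_
  rw [integral_add (h12 i) (h.integrable_errorTerm₃ (φ j) i),
    integral_add (h.integrable_errorTerm₁ (φ j) i) (h.integrable_errorTerm₂ hp (φ j) i),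
    integral_const_mul]

/-- Mollifying a supersolution on the ball and adding a multiple of the paraboloid gives a smooth
approximate supersolution. -/
theorem isApproxSupersolution (h : IsBallSupersolution p U G B m M C₀) (hp : ∀ i, 1 < p i)
    (hM : 0 ≤ M) (hC₀ : 0 ≤ C₀) {φ : ContDiffBump (0 : EuclideanSpace ℝ (Fin n) × ℝ)}
    (hφ : φ.rOut < 1) {k : ℝ} (hk : k ≤ m + M) :
    IsApproxSupersolution (fun z ↦ mollify volume φ U z + M * paraboloid z)
      (fun i ↦ mollify volume φ (B i)) (mollificationError G B M φ) k M (2 * M)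
      (n * (C₀ + 2 * M)) := by
  have hUl := h.integrable.locallyIntegrable
  have hge : ∀ z, m ≤ mollify volume φ U z := le_mollify φ hUl h.lower
  have hsub : ∀ z, mollify volume φ U z + M * paraboloid z < k →
      z ∈ closedBall (0 : EuclideanSpace ℝ (Fin n) × ℝ) 1 := fun z hz ↦ by
    refine mem_closedBall_of_paraboloid_lt ?_
    have := hge z
    -- Where the paraboloid is at least `1`, the sum is at least `m + M ≥ k`.
    by_contra hc
    nlinarith [mul_le_mul_of_nonneg_left (not_lt.1 hc) hM]
  have hU1 := contDiff_mollify φ hUl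
  have hfd : ∀ z y, fderiv ℝ (fun z ↦ mollify volume φ U z + M * paraboloid z) z y
      = fderiv ℝ (mollify volume φ U) z y + M * fderiv ℝ paraboloid z y := fun z y ↦ by
    have h1 := (hU1.differentiable one_ne_zero z).hasFDerivAt
    have h2 := ((contDiff_paraboloid.differentiable one_ne_zero z).hasFDerivAt).const_mul M
    rw [HasFDerivAt.fderiv (f := fun z ↦ mollify volume φ U z + M * paraboloid z) (h1.add h2)]
    simp
  constructor
  · exact hU1.add (contDiff_const.mul contDiff_paraboloid)
  · exact fun i ↦ contDiff_mollify φ (h.integrable_flux i).locallyIntegrable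
  · exact hsub
  · intro z
    have := hge z
    have := mul_nonneg hM (paraboloid_nonneg z)
    linarith
  · intro z hz
    have h1 := h.sum_fderiv_mollify_le hφ (hsub z hz)
    have h2 := mul_le_mul_of_nonneg_left (fderiv_paraboloid_time_ge (hsub z hz)) hM
    rw [hfd]
    linarith
  · filter_upwards [h.coercive] with z hz hzk
    have hzb := hsub z hzk
    have hsum : (n : ℝ) * (C₀ + 2 * M) = ∑ _i : Fin n, (C₀ + 2 * M) := by
      rw [Finset.sum_const, Finset.card_univ, Fintype.card_fin, nsmul_eq_mul]
    rw [hsum, mollificationError, ← Finset.sum_add_distrib, ← Finset.sum_add_distrib]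
    refine Finset.sum_le_sum fun i _ ↦ ?_
    rw [hfd, h.fderiv_mollify_eq hφ hzb]
    have hD := abs_fderiv_paraboloid_single hzb i
    set d := fderiv ℝ paraboloid z (EuclideanSpace.single i 1, 0)
    set g := mollify volume φ (G i) z
    set b := mollify volume φ (B i) z
    -- The mollified quantities are compared with the original ones, for which coercivity holds
    -- pointwise. The paraboloid adds at most `2 M` to the derivative, and its product with the flux
    -- is absorbed by the term `2 M |B_i|` built into the coercivity hypothesis.
    have e1 : |g + M * d| ≤ |G i z| + |g - G i z| + 2 * M := by
      have : g + M * d = G i z + (g - G i z) + M * d := by ring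
      rw [this]
      refine (abs_add_three _ _ _).trans ?_
      rw [abs_mul, abs_of_nonneg hM]
      linarith [mul_le_mul_of_nonneg_left hD hM]
    have e2 : B i z * G i z - |b * g - B i z * G i z| ≤ b * g := by
      linarith [neg_abs_le (b * g - B i z * G i z)]
    have e3 : -(2 * M * |b|) ≤ b * (M * d) := by
      have : |b * (M * d)| ≤ 2 * M * |b| := by
        rw [abs_mul, abs_mul, abs_of_nonneg hM]
        nlinarith [mul_le_mul_of_nonneg_left hD (mul_nonneg hM (abs_nonneg b))]
      linarith [neg_abs_le (b * (M * d))]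
    have e4 : 2 * M * |b| ≤ 2 * M * |B i z| + 2 * M * |b - B i z| := by
      have : |b| ≤ |B i z| + |b - B i z| := by
        have := abs_add_le (B i z) (b - B i z)
        rwa [add_sub_cancel] at this
      nlinarith
    have e5 := hz i
    rw [mul_add]
    linarith
  · intro z
    exact Finset.sum_nonneg fun i _ ↦ by positivity
  · exact h.integrable_mollificationError hp φ
  · exact hM
  · positivity
  · positivity

end IsBallSupersolution

end Mollified


/-! ### De Giorgi iteration -/

/-- Fast geometric convergence. -/
theorem le_mul_pow_of_le_mul_rpow {Y : ℕ → ℝ} {C b α : ℝ} (hY : ∀ j, 0 ≤ Y j) (hC : 0 ≤ C)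
    (hb : 0 < b) (hα : 0 < α) (h : ∀ j, Y (j + 1) ≤ C * b ^ j * Y j ^ (1 + α))
    (h0 : C * Y 0 ^ α ≤ b ^ (-1 / α)) (j : ℕ) : Y j ≤ Y 0 * (b ^ (-1 / α)) ^ j := by
  set ρ := b ^ (-1 / α) with hρ
  have hρ0 : 0 < ρ := Real.rpow_pos_of_pos hb _
  -- This identity is what selects `ρ`: the growth `b ^ j` of the recursion is exactly cancelled by
  -- the decay `(ρ ^ α) ^ j`.
  have hbρ : b * ρ ^ α = 1 := by
    rw [hρ, ← Real.rpow_mul hb.le, div_mul_cancel₀ _ hα.ne', Real.rpow_neg_one,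
      mul_inv_cancel₀ hb.ne']
  induction j with
  | zero => simp
  | succ j ih =>
    have h1 : Y j ^ (1 + α) ≤ (Y 0 * ρ ^ j) ^ (1 + α) :=
      Real.rpow_le_rpow (hY j) ih (by positivity)
    have hY0 := hY 0
    have h2 : (Y 0 * ρ ^ j) ^ (1 + α) = (Y 0 * ρ ^ j) * (Y 0 ^ α * (ρ ^ α) ^ j) := by
      rw [Real.rpow_add_of_nonneg (by positivity) zero_le_one hα.le, Real.rpow_one,
        Real.mul_rpow hY0 (by positivity), ← Real.rpow_natCast ρ, ← Real.rpow_natCast (ρ ^ α),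
        ← Real.rpow_mul hρ0.le, ← Real.rpow_mul hρ0.le, mul_comm α]
    calc Y (j + 1) ≤ C * b ^ j * ((Y 0 * ρ ^ j) * (Y 0 ^ α * (ρ ^ α) ^ j)) :=
          (h j).trans (mul_le_mul_of_nonneg_left (h1.trans_eq h2) (by positivity))
      _ = Y 0 * ρ ^ j * (C * Y 0 ^ α) * (b * ρ ^ α) ^ j := by rw [mul_pow]; ring
      _ ≤ Y 0 * ρ ^ j * ρ := by
          rw [hbρ, one_pow, mul_one]
          exact mul_le_mul_of_nonneg_left h0 (by positivity)
      _ = _ := by ring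

/-- A sequence of bump functions with supports shrinking to the origin. -/
noncomputable def shrinkingBump (X : Type*) [NormedAddCommGroup X] (j : ℕ) :
    ContDiffBump (0 : X) where
  rIn := 1 / (j + 3)
  rOut := 1 / (j + 2)
  rIn_pos := by positivity
  rIn_lt_rOut := one_div_lt_one_div_of_lt (by positivity) (by linarith)

theorem tendsto_rOut_shrinkingBump (X : Type*) [NormedAddCommGroup X] :
    Tendsto (fun j ↦ (shrinkingBump X j).rOut) atTop (𝓝 0) := by
  have h := (tendsto_const_div_atTop_nhds_zero_nat (1 : ℝ)).comp (tendsto_add_atTop_nat 2)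
  refine h.congr fun j ↦ ?_
  simp [shrinkingBump]

theorem rOut_shrinkingBump_lt_one (X : Type*) [NormedAddCommGroup X] (j : ℕ) :
    (shrinkingBump X j).rOut < 1 := by
  change 1 / ((j : ℝ) + 2) < 1
  rw [div_lt_one (by positivity)]
  have : (0 : ℝ) ≤ j := j.cast_nonneg
  linarith

/-- A Chebyshev-type bound: where `w < h`, the truncation at level `k` is at least `k - h`. -/
theorem max_sub_zero_le_rpow_mul {h k w r : ℝ} (hhk : h < k) (hr : 0 ≤ r) :
    max (h - w) 0 ≤ ((k - h) ^ r)⁻¹ * max (k - w) 0 ^ (1 + r) := by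
  have hkh : 0 < k - h := sub_pos.2 hhk
  rcases le_or_gt h w with hw | hw
  · rw [max_eq_right (by linarith)]
    have : 0 ≤ max (k - w) 0 := le_max_right _ _
    positivity
  · have hv : max (k - w) 0 = k - w := max_eq_left (by linarith)
    have hkw : 0 < k - w := by linarith
    rw [max_eq_left (by linarith), hv, Real.rpow_add_of_nonneg hkw.le zero_le_one hr,
      Real.rpow_one, inv_mul_eq_div, le_div_iff₀ (by positivity)]
    exact mul_le_mul (by linarith) (Real.rpow_le_rpow hkh.le (by linarith) hr)
      (by positivity) hkw.le

namespace IsBallSupersolution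

variable {n : ℕ} {p : Fin n → ℝ} {U : EuclideanSpace ℝ (Fin n) × ℝ → ℝ}
  {G B : Fin n → EuclideanSpace ℝ (Fin n) × ℝ → ℝ} {m M C₀ : ℝ}

theorem abs_trunc_mollify_sub_le (φ : ContDiffBump (0 : EuclideanSpace ℝ (Fin n) × ℝ)) (k : ℝ)
    (z : EuclideanSpace ℝ (Fin n) × ℝ) :
    |max (k - (mollify volume φ U z + M * paraboloid z)) 0 - max (k - (U z + M * paraboloid z)) 0|
      ≤ |mollify volume φ U z - U z| := by
  refine (abs_max_sub_max_le_abs _ _ _).trans_eq ?_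
  rw [abs_sub_comm]
  congr 1
  ring

theorem integrable_trunc (h : IsBallSupersolution p U G B m M C₀) (hp : ∀ i, 1 < p i)
    (hM : 0 ≤ M) (hC₀ : 0 ≤ C₀) {k : ℝ} (hk : k ≤ m + M) :
    Integrable fun z ↦ max (k - (U z + M * paraboloid z)) 0 := by
  set φ := shrinkingBump (EuclideanSpace ℝ (Fin n) × ℝ) 0
  have h1 := (h.isApproxSupersolution hp hM hC₀ (rOut_shrinkingBump_lt_one _ 0) hk).integrable_trunc
  have hm : AEStronglyMeasurable (fun z ↦ max (k - (U z + M * paraboloid z)) 0) volume := by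
    have h2 : AEMeasurable U volume := h.integrable.1.aemeasurable
    have h3 : Measurable (paraboloid (n := n)) := contDiff_paraboloid.continuous.measurable
    exact ((aemeasurable_const.sub (h2.add (h3.aemeasurable.const_mul M))).max
      aemeasurable_const).aestronglyMeasurable
  have h2 : Integrable fun z ↦ max (k - (mollify volume φ U z + M * paraboloid z)) 0
      - max (k - (U z + M * paraboloid z)) 0 :=
    ((integrable_mollify φ h.integrable).sub h.integrable).mono (h1.1.sub hm)
      (ae_of_all _ fun z ↦ by
        simpa only [Real.norm_eq_abs, Pi.sub_apply] using abs_trunc_mollify_sub_le φ k z)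
  exact (h1.sub h2).congr (ae_of_all _ fun z ↦ sub_sub_cancel _ _)

theorem tendsto_integral_trunc (h : IsBallSupersolution p U G B m M C₀) (hp : ∀ i, 1 < p i)
    (hM : 0 ≤ M) (hC₀ : 0 ≤ C₀) {k : ℝ} (hk : k ≤ m + M) :
    Tendsto (fun j ↦ ∫ z, max (k - (mollify volume (shrinkingBump _ j) U z
      + M * paraboloid z)) 0) atTop (𝓝 (∫ z, max (k - (U z + M * paraboloid z)) 0)) := by
  have hlim := tendsto_integral_abs_mollify_sub h.integrable (tendsto_rOut_shrinkingBump _)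
  rw [tendsto_iff_norm_sub_tendsto_zero]
  refine squeeze_zero (fun _ ↦ norm_nonneg _) (fun j ↦ ?_) hlim
  have h1 := (h.isApproxSupersolution hp hM hC₀ (rOut_shrinkingBump_lt_one _ j) hk).integrable_trunc
  have h2 := h.integrable_trunc hp hM hC₀ hk
  rw [← integral_sub h1 h2]
  refine (norm_integral_le_integral_norm _).trans (integral_mono (h1.sub h2).norm
    ((integrable_mollify _ h.integrable).sub h.integrable).abs fun z ↦ ?_)
  rw [Real.norm_eq_abs]
  exact abs_trunc_mollify_sub_le _ k z

/-- The recursion between two levels holds for each mollification, with an error that vanishes as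
the kernels shrink. The constant is chosen before `U` and `m`, which later makes it independent of
position and scale. -/
theorem exists_integral_trunc_le (hn : 2 ≤ n) (hp : ∀ i, 1 < p i) (hM : 0 ≤ M) (hC₀ : 0 ≤ C₀) :
    ∃ K : ℝ, 0 ≤ K ∧ ∀ {U : EuclideanSpace ℝ (Fin n) × ℝ → ℝ}
      {G B : Fin n → EuclideanSpace ℝ (Fin n) × ℝ → ℝ} {m : ℝ},
      IsBallSupersolution p U G B m M C₀ → ∀ {l k : ℝ}, l < k → k ≤ m + M →
        ∫ z, max (l - (U z + M * paraboloid z)) 0 ≤ ((k - l) ^ (1 + 3 / n : ℝ))⁻¹ *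
          (K * (∫ z, max (k - (U z + M * paraboloid z)) 0) ^ (1 + 1 / n : ℝ)) := by
  obtain ⟨K, hK0, hK⟩ := IsApproxSupersolution.exists_integral_rpow_le hn
  -- The factor `Θ M + 2 C₀` of the energy estimate, with the values of `Θ` and of the coercivity
  -- constant produced by `isApproxSupersolution`.
  set A : ℝ := 2 * M * M + 2 * (n * (C₀ + 2 * M)) with hA
  have hA0 : 0 ≤ A := by positivity
  refine ⟨K * A ^ (1 + 1 / n : ℝ), by positivity, fun {U G B m} h l k hlk hk ↦ ?_⟩
  have hl := h.tendsto_integral_trunc hp hM hC₀ (hlk.le.trans hk)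
  have hk' := h.tendsto_integral_trunc hp hM hC₀ hk
  have he := h.tendsto_integral_mollificationError hp (tendsto_rOut_shrinkingBump _)
  have hr := ((((hk'.const_mul A).add (he.const_mul (2 * M))).rpow_const
    (p := 1 + 1 / n) (Or.inr (by positivity))).const_mul K).const_mul
      ((k - l) ^ (1 + 3 / n : ℝ))⁻¹
  have hI0 : 0 ≤ ∫ z, max (k - (U z + M * paraboloid z)) 0 :=
    integral_nonneg fun z ↦ le_max_right _ _
  rw [mul_zero, add_zero, Real.mul_rpow hA0 hI0, ← mul_assoc K] at hr
  refine le_of_tendsto_of_tendsto' hl hr fun j ↦ ?_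
  have ha := h.isApproxSupersolution hp hM hC₀ (rOut_shrinkingBump_lt_one _ j) hk
  have hal := h.isApproxSupersolution hp hM hC₀ (rOut_shrinkingBump_lt_one _ j) (hlk.le.trans hk)
  have hkl : 0 < k - l := sub_pos.2 hlk
  have hexp : (2 + 3 / n : ℝ) = 1 + (1 + 3 / n) := by ring
  have hint : Integrable fun z ↦ max (k - (mollify volume (shrinkingBump _ j) U z
      + M * paraboloid z)) 0 ^ (1 + (1 + 3 / n) : ℝ) := by
    have hpos : (0 : ℝ) < 1 + (1 + 3 / n) := by positivity
    refine (ha.continuous_trunc.rpow_const fun _ ↦ Or.inr hpos.le).integrable_of_hasCompactSupport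
      (ha.hasCompactSupport.comp_left (g := fun s : ℝ ↦ s ^ (1 + (1 + 3 / n) : ℝ))
        (Real.zero_rpow hpos.ne'))
  calc _ ≤ ∫ z, ((k - l) ^ (1 + 3 / n : ℝ))⁻¹ * max (k - (mollify volume (shrinkingBump _ j) U z
      + M * paraboloid z)) 0 ^ (1 + (1 + 3 / n) : ℝ) :=
        integral_mono hal.integrable_trunc (hint.const_mul _) fun z ↦
          max_sub_zero_le_rpow_mul hlk (by positivity)
    _ ≤ _ := by
        rw [integral_const_mul, ← hexp]
        exact mul_le_mul_of_nonneg_left (hK ha) (by positivity)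

/-- De Giorgi's lemma: a small excess below the level `k` vanishes below a lower level. -/
theorem exists_ae_le_of_integral_trunc_le (hn : 2 ≤ n) (hp : ∀ i, 1 < p i) (hM : 0 ≤ M)
    (hC₀ : 0 ≤ C₀) {d : ℝ} (hd : 0 < d) : ∃ ν : ℝ, 0 < ν ∧
    ∀ {U : EuclideanSpace ℝ (Fin n) × ℝ → ℝ} {G B : Fin n → EuclideanSpace ℝ (Fin n) × ℝ → ℝ}
      {m k : ℝ}, IsBallSupersolution p U G B m M C₀ → k ≤ m + M →
      ∫ z, max (k - (U z + M * paraboloid z)) 0 ≤ ν →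
      ∀ᵐ z, k - d ≤ U z + M * paraboloid z := by
  obtain ⟨K, hK0, hK⟩ := exists_integral_trunc_le hn hp hM hC₀
  have hn0 : (0 : ℝ) < n := by exact_mod_cast (by omega : 0 < n)
  set r : ℝ := 1 + 3 / n with hr
  have hr0 : 0 < r := by positivity
  set b : ℝ := 2 ^ r with hb
  have hb0 : 1 < b := Real.one_lt_rpow one_lt_two hr0
  set C : ℝ := (d ^ r)⁻¹ * b * K with hC
  have hC0 : 0 ≤ C := by positivity
  set ρ : ℝ := b ^ (-1 / (1 / n : ℝ)) with hρ
  have hρ0 : 0 < ρ := by positivity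
  have hρ1 : ρ < 1 := Real.rpow_lt_one_of_one_lt_of_neg hb0 (by
    rw [neg_div, neg_lt_zero]; positivity)
  obtain ⟨ν, hν0, hν⟩ : ∃ ν : ℝ, 0 < ν ∧ C * ν ^ (1 / n : ℝ) ≤ ρ := by
    -- With this value `C ν^{1/n} = C ρ / (C + 1) ≤ ρ`, the starting condition of the iteration.
    refine ⟨(ρ / (C + 1)) ^ (n : ℝ), by positivity, ?_⟩
    rw [← Real.rpow_mul (by positivity), mul_one_div_cancel hn0.ne', Real.rpow_one,
      mul_div_assoc', div_le_iff₀ (by positivity)]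
    nlinarith
  refine ⟨ν, hν0, fun {U G B m k} h hk hle ↦ ?_⟩
  set Y : ℝ → ℝ := fun k ↦ ∫ z, max (k - (U z + M * paraboloid z)) 0 with hY
  have hY0 : ∀ k, 0 ≤ Y k := fun k ↦ integral_nonneg fun z ↦ le_max_right _ _
  -- Levels decreasing from `k` to `k - d`, with gaps `d / 2^{j+1}`; these gaps account for `b = 2 ^
  -- r` and for the extra factor `b` in `C`.
  set κ : ℕ → ℝ := fun j ↦ k - d + d * (1 / 2) ^ j with hκ
  have hκk : ∀ j, κ j ≤ k := fun j ↦ by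
    have : (1 / 2 : ℝ) ^ j ≤ 1 := pow_le_one₀ (by norm_num) (by norm_num)
    simp only [hκ]
    nlinarith
  have hdiff : ∀ j, κ j - κ (j + 1) = d * ((2 : ℝ) ^ (j + 1))⁻¹ := fun j ↦ by
    simp only [hκ, pow_succ, one_div, inv_pow, mul_inv]
    ring
  have hrec : ∀ j, Y (κ (j + 1)) ≤ C * b ^ j * Y (κ j) ^ (1 + 1 / n : ℝ) := fun j ↦ by
    have hlt : κ (j + 1) < κ j := by
      rw [← sub_pos, hdiff]; positivity
    refine (hK h hlt ((hκk j).trans hk)).trans_eq ?_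
    rw [hdiff, Real.mul_rpow hd.le (by positivity), Real.inv_rpow (by positivity),
      ← Real.rpow_pow_comm zero_le_two, mul_inv, inv_inv, ← hb, hC, pow_succ]
    ring
  have hz : κ 0 = k := by simp [hκ]
  have hdec := le_mul_pow_of_le_mul_rpow (Y := fun j ↦ Y (κ j)) (fun j ↦ hY0 _) hC0
    (by positivity) (by positivity) hrec (by
      rw [hz]
      exact (mul_le_mul_of_nonneg_left (Real.rpow_le_rpow (hY0 _) hle (by positivity)) hC0).trans hν)
  have hkd : k - d ≤ m + M := by linarith
  have hYz : Y (k - d) ≤ 0 := by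
    have hlim : Tendsto (fun j ↦ Y (κ 0) * ρ ^ j) atTop (𝓝 0) := by
      simpa using (tendsto_pow_atTop_nhds_zero_of_lt_one hρ0.le hρ1).const_mul (Y (κ 0))
    refine ge_of_tendsto' hlim fun j ↦ le_trans ?_ (hdec j)
    refine integral_mono (h.integrable_trunc hp hM hC₀ hkd)
      (h.integrable_trunc hp hM hC₀ ((hκk j).trans hk)) fun z ↦ ?_
    refine max_le_max_right 0 ?_
    have : 0 < d * (1 / 2 : ℝ) ^ j := by positivity
    simp only [hκ]
    linarith
  have hae := (integral_eq_zero_iff_of_nonneg (fun z ↦ le_max_right _ _)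
    (h.integrable_trunc hp hM hC₀ hkd)).1 (le_antisymm hYz (hY0 _))
  filter_upwards [hae] with z hz
  have : k - d - (U z + M * paraboloid z) ≤ 0 := (le_max_left _ _).trans_eq hz
  linarith

/-- If a supersolution on the ball is below `k` only on a set of small measure, then it lies
above a lower level near the centre. -/
theorem exists_ae_le_of_measure_le (hn : 2 ≤ n) (hp : ∀ i, 1 < p i) (hM : 0 < M)
    (hC₀ : 0 ≤ C₀) {d : ℝ} (hd : 0 < d) : ∃ ν : ℝ≥0∞, 0 < ν ∧ ∃ s : ℝ, 0 < s ∧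
    ∀ {U : EuclideanSpace ℝ (Fin n) × ℝ → ℝ} {G B : Fin n → EuclideanSpace ℝ (Fin n) × ℝ → ℝ}
      {m k : ℝ}, IsBallSupersolution p U G B m M C₀ → k ≤ m + M →
      volume {z ∈ closedBall (0 : EuclideanSpace ℝ (Fin n) × ℝ) 1 | U z < k} ≤ ν →
      ∀ᵐ z, z ∈ ball (0 : EuclideanSpace ℝ (Fin n) × ℝ) s → k - 2 * d ≤ U z := by
  obtain ⟨ν, hν, H⟩ := exists_ae_le_of_integral_trunc_le hn hp hM.le hC₀ hd
  -- The truncation is at most `M` and vanishes off the sublevel set in the unit ball, hence `ν /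
  -- M`. The radius ensures `|x|²` and `t²` are at most `d / (2M)`, so removing the paraboloid costs
  -- one more `d`.
  refine ⟨ENNReal.ofReal (ν / M), by simpa using div_pos hν hM, min 1 (d / (2 * M)),
    lt_min one_pos (by positivity), fun {U G B m k} h hk hle ↦ ?_⟩
  have hint := h.integrable_trunc hp hM.le hC₀ hk
  have hY : ∫ z, max (k - (U z + M * paraboloid z)) 0 ≤ ν := by
    have h0 : ∀ z, 0 ≤ max (k - (U z + M * paraboloid z)) 0 := fun z ↦ le_max_right _ _
    rw [integral_eq_lintegral_of_nonneg_ae (ae_of_all _ h0) hint.1]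
    refine ENNReal.toReal_le_of_le_ofReal hν.le ?_
    set S := {z ∈ closedBall (0 : EuclideanSpace ℝ (Fin n) × ℝ) 1 | U z < k}
    calc ∫⁻ z, ENNReal.ofReal (max (k - (U z + M * paraboloid z)) 0)
        ≤ ∫⁻ z, (S.indicator (fun _ ↦ ENNReal.ofReal M)) z := by
          refine lintegral_mono_ae ?_
          filter_upwards [h.lower] with z hz
          have hN := mul_nonneg hM.le (paraboloid_nonneg z)
          by_cases hzS : z ∈ S
          · rw [indicator_of_mem hzS]
            exact ENNReal.ofReal_le_ofReal (max_le (by linarith) hM.le)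
          · rw [indicator_of_notMem hzS, nonpos_iff_eq_zero, ENNReal.ofReal_eq_zero]
            refine max_le (le_of_not_gt fun hpos ↦ hzS ⟨mem_closedBall_of_paraboloid_lt ?_, ?_⟩)
              le_rfl
            · by_contra hc
              nlinarith [mul_le_mul_of_nonneg_left (not_lt.1 hc) hM.le]
            · linarith
      _ ≤ ENNReal.ofReal M * volume S := by
          refine (lintegral_indicator_const_le _ _)
      _ ≤ ENNReal.ofReal M * ENNReal.ofReal (ν / M) := by gcongr
      _ = ENNReal.ofReal ν := by
          rw [← ENNReal.ofReal_mul hM.le, mul_div_cancel₀ _ hM.ne']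
  filter_upwards [H h hk hY] with z hz hzs
  rw [mem_ball_zero_iff] at hzs
  have h1 : ‖z.1‖ ≤ min 1 (d / (2 * M)) := (norm_fst_le z).trans hzs.le
  have h2 : |z.2| ≤ min 1 (d / (2 * M)) := (norm_snd_le z).trans hzs.le
  have hN : paraboloid z ≤ d / M := by
    have h3 : ‖z.1‖ ^ 2 ≤ d / (2 * M) := by
      nlinarith [norm_nonneg z.1, h1.trans (min_le_left _ _), h1.trans (min_le_right _ _)]
    have h4 : z.2 ^ 2 ≤ d / (2 * M) := by
      rw [← sq_abs]
      nlinarith [abs_nonneg z.2, h2.trans (min_le_left _ _), h2.trans (min_le_right _ _)]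
    have h5 : d / M = d / (2 * M) + d / (2 * M) := by field_simp; norm_num
    unfold paraboloid
    linarith
  have := mul_le_mul_of_nonneg_left hN hM.le
  rw [mul_div_cancel₀ _ hM.ne'] at this
  linarith

end IsBallSupersolution


/-! ### Scaling and coercivity of the flux -/

section Flux

theorem degenerateFlux_neg (q δ s : ℝ) : degenerateFlux q δ (-s) = -degenerateFlux q δ s := by
  simp [degenerateFlux, neg_div]

/-- Homogeneity holds when the threshold is scaled together with the argument; this is why the
thresholds must be allowed to vary in the later estimates. -/
theorem degenerateFlux_mul (q δ s : ℝ) {r : ℝ} (hr : 0 < r) :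
    degenerateFlux q (r * δ) (r * s) = r ^ (q - 1) * degenerateFlux q δ s := by
  have h1 : max (|r * s| - r * δ) 0 = r * max (|s| - δ) 0 := by
    rw [abs_mul, abs_of_pos hr, ← mul_sub, mul_max_of_nonneg _ _ hr.le, mul_zero]
  have h2 : r * s / |r * s| = s / |s| := by
    rw [abs_mul, abs_of_pos hr, mul_div_mul_left _ _ hr.ne']
  rw [degenerateFlux, h1, h2, Real.mul_rpow hr.le (le_max_right _ _), degenerateFlux, mul_assoc]

theorem measurable_degenerateFlux (q δ : ℝ) : Measurable (degenerateFlux q δ) := by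
  unfold degenerateFlux
  fun_prop

theorem degenerateFlux_mul_self (q δ s : ℝ) :
    degenerateFlux q δ s * s = |degenerateFlux q δ s| * |s| := by
  have : degenerateFlux q δ s * s = (max (|s| - δ) 0) ^ (q - 1) * (|s|⁻¹ * s ^ 2) := by
    unfold degenerateFlux; ring
  rw [← abs_mul, this]
  exact (abs_of_nonneg (mul_nonneg (Real.rpow_nonneg (le_max_right _ _) _)
    (mul_nonneg (inv_nonneg.2 (abs_nonneg s)) (sq_nonneg s)))).symm

theorem abs_degenerateFlux_of_ne_zero (q δ : ℝ) {s : ℝ} (hs : s ≠ 0) :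
    |degenerateFlux q δ s| = (max (|s| - δ) 0) ^ (q - 1) := by
  rw [degenerateFlux, abs_mul, abs_div, abs_abs, div_self (abs_ne_zero.2 hs), mul_one,
    abs_of_nonneg (Real.rpow_nonneg (le_max_right _ _) _)]

theorem abs_degenerateFlux_le {q δ : ℝ} (hq : 1 < q) (hδ : 0 ≤ δ) (s : ℝ) :
    |degenerateFlux q δ s| ≤ |s| ^ (q - 1) := by
  rcases eq_or_ne s 0 with rfl | hs
  · simp [degenerateFlux, Real.zero_rpow (sub_pos.2 hq).ne']
  · rw [abs_degenerateFlux_of_ne_zero _ _ hs]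
    exact Real.rpow_le_rpow (le_max_right _ _) (max_le (by linarith) (abs_nonneg s))
      (sub_pos.2 hq).le

/-- The flux controls the gradient, uniformly for degeneracy thresholds in `[0, δ]`. -/
theorem exists_abs_add_le_flux_mul {q δ Λ c : ℝ} (hq : 1 < q) (hδ : 0 ≤ δ) (hΛ : 1 ≤ Λ)
    (hc : 0 ≤ c) : ∃ C : ℝ, 0 ≤ C ∧ ∀ η, η ≤ δ → 0 ≤ η → ∀ a, Λ⁻¹ ≤ a → a ≤ Λ → ∀ s : ℝ,
      |s| + c * |a * degenerateFlux q η s| ≤ a * degenerateFlux q η s * s + C := by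
  have hq1 : 0 < q - 1 := sub_pos.2 hq
  -- For `|s| ≥ R` the weighted flux is at least `2` in absolute value, so half of `F(s) s = |F|
  -- |s|` dominates `|s|`. For `|s| ≥ 2c` the other half dominates `c |F|`. Below `S` everything is
  -- bounded by the constant.
  set R : ℝ := δ + (2 * Λ) ^ (1 / (q - 1)) with hR
  set S : ℝ := max (2 * c) R with hS
  have hR0 : 0 < R := by positivity
  have hS0 : 0 < S := hR0.trans_le (le_max_right _ _)
  refine ⟨S + c * (Λ * S ^ (q - 1)), by positivity, fun η hη hη0 a ha1 ha2 s ↦ ?_⟩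
  have hΛ0 : 0 < Λ := by linarith
  have ha0 : 0 < a := (inv_pos.2 hΛ0).trans_le ha1
  have hflux : a * degenerateFlux q η s * s = |a * degenerateFlux q η s| * |s| := by
    rw [mul_assoc, degenerateFlux_mul_self, abs_mul, abs_of_pos ha0, mul_assoc]
  rw [hflux]
  have hF0 := abs_nonneg (a * degenerateFlux q η s)
  rcases le_or_gt S |s| with hs | hs
  · have hs0 : s ≠ 0 := by
      rintro rfl
      rw [abs_zero] at hs
      linarith
    have hF2 : 2 ≤ |a * degenerateFlux q η s| := by
      rw [abs_mul, abs_of_pos ha0, abs_degenerateFlux_of_ne_zero _ _ hs0]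
      have h1 : (2 * Λ) ^ (1 / (q - 1)) ≤ max (|s| - η) 0 :=
        le_max_of_le_left (by linarith [(le_max_right (2 * c) R).trans hs])
      have h2 : 2 * Λ ≤ max (|s| - η) 0 ^ (q - 1) := by
        have := Real.rpow_le_rpow (by positivity) h1 hq1.le
        rwa [← Real.rpow_mul (by positivity), one_div_mul_cancel hq1.ne', Real.rpow_one] at this
      calc (2 : ℝ) = Λ⁻¹ * (2 * Λ) := by field_simp
        _ ≤ a * max (|s| - η) 0 ^ (q - 1) := mul_le_mul ha1 h2 (by positivity) ha0.le
    have h3 : 2 * c ≤ |s| := (le_max_left _ _).trans hs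
    have h4 : 0 ≤ S + c * (Λ * S ^ (q - 1)) := by positivity
    nlinarith [mul_le_mul_of_nonneg_left h3 hF0, mul_le_mul_of_nonneg_right hF2 (abs_nonneg s)]
  · have hFS : |a * degenerateFlux q η s| ≤ Λ * S ^ (q - 1) := by
      rw [abs_mul, abs_of_pos ha0]
      exact mul_le_mul ha2 ((abs_degenerateFlux_le hq hη0 s).trans
        (Real.rpow_le_rpow (abs_nonneg s) hs.le hq1.le)) (abs_nonneg _) hΛ0.le
    have h1 := mul_le_mul_of_nonneg_left hFS hc
    have h2 := mul_nonneg hF0 (abs_nonneg s)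
    linarith

end Flux

/-! ### From slicewise to space-time weak gradients -/

section WeakGradient

variable {n : ℕ} {Ω : Set (EuclideanSpace ℝ (Fin n))} {T : ℝ}

theorem IsTestFunction.slice {ψ : EuclideanSpace ℝ (Fin n) × ℝ → ℝ}
    (hψ : IsTestFunction (cylinder Ω T) ψ) (t : ℝ) : IsTestFunction Ω fun x ↦ ψ (x, t) where
  smooth := hψ.smooth.comp (contDiff_id.prodMk contDiff_const)
  compact_support := hasCompactSupport_slice_left hψ.compact_support t
  support_subset := by
    have hcl : IsClosed ((fun x ↦ (x, t)) ⁻¹' tsupport ψ) :=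
      (isClosed_tsupport ψ).preimage (by fun_prop)
    have h1 : tsupport (fun x ↦ ψ (x, t)) ⊆ (fun x ↦ (x, t)) ⁻¹' tsupport ψ :=
      closure_minimal (fun x hx ↦ subset_tsupport ψ hx) hcl
    exact fun x hx ↦ (hψ.support_subset (h1 hx)).1

/-- A locally integrable function times a continuous function with compact support. -/
theorem MemLpLoc.integrableOn_mul {X : Type*} [TopologicalSpace X] [T2Space X] [MeasureSpace X]
    [OpensMeasurableSpace X]
    {f : X → ℝ} {S : Set X} (hf : MemLpLoc f 1 S) {ψ : X → ℝ} (hψ : Continuous ψ)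
    (hc : HasCompactSupport ψ) {K : Set X} (hK : IsCompact K) (hKS : K ⊆ S)
    (hψK : ∀ x, x ∉ K → ψ x = 0) : Integrable fun x ↦ f x * ψ x := by
  obtain ⟨C, hC⟩ := hc.exists_bound_of_continuous hψ
  have h1 : IntegrableOn f K := by
    have := hf K hK hKS
    rwa [ENNReal.ofReal_one, memLp_one_iff_integrable] at this
  have h2 : IntegrableOn (fun x ↦ f x * ψ x) K :=
    h1.mul_bdd (c := C) hψ.measurable.aestronglyMeasurable (ae_of_all _ hC)
  exact (integrableOn_iff_integrable_of_support_subset fun x hx ↦ by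
    by_contra hne
    exact hx (by simp [hψK x hne])).1 h2

/-- Fubini: a slice of a space-time test function is a test function on `Ω`, so the identity holds
on almost every time slice. -/
theorem MemParabolicSobolevLoc.setIntegral_mul_fderiv {p : Fin n → ℝ}
    {u : EuclideanSpace ℝ (Fin n) × ℝ → ℝ} {g : Fin n → EuclideanSpace ℝ (Fin n) × ℝ → ℝ}
    (h : MemParabolicSobolevLoc Ω T p u g) (i : Fin n)
    {ψ : EuclideanSpace ℝ (Fin n) × ℝ → ℝ} (hψ : IsTestFunction (cylinder Ω T) ψ) :
    ∫ z in cylinder Ω T, u z * fderiv ℝ ψ z (EuclideanSpace.single i 1, 0)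
      = -∫ z in cylinder Ω T, g i z * ψ z := by
  have hψ1 : ContDiff ℝ 1 ψ := hψ.smooth.of_le (by simp)
  have hi1 : Integrable fun z ↦ u z * fderiv ℝ ψ z (EuclideanSpace.single i 1, 0) :=
    h.memLpLoc_one.integrableOn_mul
      ((hψ1.continuous_fderiv one_ne_zero).clm_apply continuous_const)
      (hψ.compact_support.fderiv_apply ℝ _) hψ.compact_support.isCompact hψ.support_subset
      fun z hz ↦ by rw [fderiv_of_notMem_tsupport (𝕜 := ℝ) hz]; rfl
  have hi2 : Integrable fun z ↦ g i z * ψ z :=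
    (h.grad_memLpLoc_one i).integrableOn_mul hψ1.continuous hψ.compact_support
      hψ.compact_support.isCompact hψ.support_subset fun z hz ↦ image_eq_zero_of_notMem_tsupport hz
  have hr : (volume : Measure (EuclideanSpace ℝ (Fin n) × ℝ)).restrict (cylinder Ω T)
      = (volume.restrict Ω).prod (volume.restrict (Ioo 0 T)) := by
    rw [cylinder, Measure.volume_eq_prod, Measure.prod_restrict]
  have hj1 := hi1.integrableOn (s := cylinder Ω T)
  have hj2 := hi2.integrableOn (s := cylinder Ω T)
  rw [IntegrableOn, hr] at hj1 hj2
  rw [hr, integral_prod_symm _ hj1, integral_prod_symm _ hj2, ← integral_neg]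
  refine integral_congr_ae ?_
  filter_upwards [h.slice] with t ht
  have := ht.integral_eq i _ (hψ.slice t)
  simpa only [fderiv_slice hψ1] using this

end WeakGradient

/-! ### Anisotropic dilations and change of variables -/

section Dilation

variable {n : ℕ}

/-- The anisotropic dilation `(x, t) ↦ ((r_i x_i)_i, τ t)`. -/
noncomputable def dilation (r : Fin n → ℝ) (τ : ℝ) (hr : ∀ i, r i ≠ 0) (hτ : τ ≠ 0) :
    (EuclideanSpace ℝ (Fin n) × ℝ) ≃L[ℝ] (EuclideanSpace ℝ (Fin n) × ℝ) :=
  LinearEquiv.toContinuousLinearEquiv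
    { toFun := fun z ↦ (WithLp.toLp 2 fun i ↦ r i * z.1 i, τ * z.2)
      invFun := fun z ↦ (WithLp.toLp 2 fun i ↦ (r i)⁻¹ * z.1 i, τ⁻¹ * z.2)
      map_add' := fun y z ↦ by ext <;> simp [mul_add]
      map_smul' := fun c z ↦ by ext <;> simp [mul_left_comm]
      left_inv := fun z ↦ by ext <;> simp [hr, hτ]
      right_inv := fun z ↦ by ext <;> simp [hr, hτ] }

variable {r : Fin n → ℝ} {τ : ℝ} (hr : ∀ i, r i ≠ 0) (hτ : τ ≠ 0)

theorem dilation_apply (z : EuclideanSpace ℝ (Fin n) × ℝ) :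
    dilation r τ hr hτ z = (WithLp.toLp 2 fun i ↦ r i * z.1 i, τ * z.2) := rfl

theorem dilation_symm_apply (z : EuclideanSpace ℝ (Fin n) × ℝ) :
    (dilation r τ hr hτ).symm z = (WithLp.toLp 2 fun i ↦ (r i)⁻¹ * z.1 i, τ⁻¹ * z.2) := rfl

theorem dilation_symm_single (i : Fin n) : (dilation r τ hr hτ).symm (EuclideanSpace.single i 1, 0)
    = (r i)⁻¹ • (EuclideanSpace.single i 1, 0) := by
  rw [dilation_symm_apply]
  refine Prod.ext ?_ (by simp)
  ext j
  by_cases h : j = i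
  · subst h; simp
  · simp [h]

theorem dilation_symm_time : (dilation r τ hr hτ).symm ((0 : EuclideanSpace ℝ (Fin n)), 1)
    = τ⁻¹ • (0, 1) := by
  rw [dilation_symm_apply]
  refine Prod.ext ?_ (by simp)
  ext j
  simp

theorem norm_dilation_le {ρ : ℝ} (hrρ : ∀ i, |r i| ≤ ρ) (hτρ : |τ| ≤ ρ)
    (z : EuclideanSpace ℝ (Fin n) × ℝ) : ‖dilation r τ hr hτ z‖ ≤ ρ * ‖z‖ := by
  have hρ : 0 ≤ ρ := (abs_nonneg _).trans hτρ
  rw [dilation_apply, Prod.norm_def, max_le_iff]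
  constructor
  · refine le_trans ?_ (mul_le_mul_of_nonneg_left (norm_fst_le z) hρ)
    rw [EuclideanSpace.norm_eq, EuclideanSpace.norm_eq, ← Real.sqrt_sq hρ,
      ← Real.sqrt_mul (sq_nonneg ρ), Finset.mul_sum]
    refine Real.sqrt_le_sqrt (Finset.sum_le_sum fun i _ ↦ ?_)
    rw [← mul_pow]
    refine pow_le_pow_left₀ (norm_nonneg _) ?_ 2
    simp only [norm_mul, Real.norm_eq_abs]
    exact mul_le_mul_of_nonneg_right (hrρ i) (abs_nonneg _)
  · rw [norm_mul, Real.norm_eq_abs]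
    exact mul_le_mul hτρ (norm_snd_le z) (norm_nonneg _) hρ

end Dilation

section AffineChange

variable {X : Type*} [NormedAddCommGroup X] [NormedSpace ℝ X] [FiniteDimensional ℝ X]
  [MeasurableSpace X] [BorelSpace X] (μ : Measure X) [μ.IsAddHaarMeasure]

theorem exists_measurePreserving_add_linearEquiv (L : X ≃L[ℝ] X) (z₀ : X) :
    ∃ c : ℝ≥0∞, c ≠ 0 ∧ c ≠ ⊤ ∧ MeasurePreserving (fun z ↦ z₀ + L z) μ (c • μ) := by
  have hm : Measurable fun z ↦ z₀ + L z := (continuous_const.add L.continuous).measurable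
  refine ⟨ENNReal.ofReal |LinearMap.det (L.symm : X →ₗ[ℝ] X)|, ?_, ENNReal.ofReal_ne_top, hm, ?_⟩
  · simpa using (LinearEquiv.isUnit_det' L.symm.toLinearEquiv).ne_zero
  · ext s hs
    rw [Measure.map_apply hm hs, Measure.smul_apply,
      smul_eq_mul]
    have : (fun z ↦ z₀ + L z) ⁻¹' s = L ⁻¹' ((fun y ↦ z₀ + y) ⁻¹' s) := rfl
    rw [this, Measure.addHaar_preimage_continuousLinearEquiv, measure_preimage_add]

end AffineChange


section ChangeOfVariables

variable {X : Type*} [NormedAddCommGroup X] [NormedSpace ℝ X] {L : X ≃L[ℝ] X} {z₀ : X}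

theorem IsTestFunction.comp_affine_symm {S V : Set X} {φ : X → ℝ} (hφ : IsTestFunction S φ)
    (hSV : MapsTo (fun z ↦ z₀ + L z) S V) :
    IsTestFunction V fun y ↦ φ (L.symm (y - z₀)) where
  smooth := hφ.smooth.comp (L.symm.contDiff.comp (contDiff_id.sub contDiff_const))
  compact_support := hφ.compact_support.comp_homeomorph
    ((Homeomorph.subRight z₀).trans L.symm.toHomeomorph)
  support_subset := by
    have hcl : IsClosed ((fun y ↦ L.symm (y - z₀)) ⁻¹' tsupport φ) :=
      (isClosed_tsupport φ).preimage (L.symm.continuous.comp (continuous_id.sub continuous_const))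
    have h1 : tsupport (fun y ↦ φ (L.symm (y - z₀))) ⊆ (fun y ↦ L.symm (y - z₀)) ⁻¹' tsupport φ :=
      closure_minimal (fun x hx ↦ subset_tsupport φ hx) hcl
    intro y hy
    simpa using hSV (hφ.support_subset (h1 hy))

theorem fderiv_comp_affine_symm {φ : X → ℝ} (hφ : ContDiff ℝ 1 φ) (z e : X) :
    fderiv ℝ (fun y ↦ φ (L.symm (y - z₀))) (z₀ + L z) e = fderiv ℝ φ z (L.symm e) := by
  have h1 : HasFDerivAt (fun y ↦ L.symm (y - z₀)) (L.symm : X →L[ℝ] X) (z₀ + L z) := by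
    have := (L.symm : X →L[ℝ] X).hasFDerivAt.comp (z₀ + L z)
      ((hasFDerivAt_id (𝕜 := ℝ) (z₀ + L z)).sub_const z₀)
    simpa [Function.comp_def] using this
  have h2 : HasFDerivAt φ (fderiv ℝ φ z) (L.symm (z₀ + L z - z₀)) := by
    simpa using (hφ.differentiable one_ne_zero z).hasFDerivAt
  have h3 := HasFDerivAt.comp (z₀ + L z) h2 h1
  rw [HasFDerivAt.fderiv (f := fun y ↦ φ (L.symm (y - z₀))) h3]
  rfl

theorem IsTestFunction.indicator_mul {S : Set X} {φ : X → ℝ} (hφ : IsTestFunction S φ)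
    (f : X → ℝ) (z : X) : S.indicator f z * φ z = f z * φ z := by
  by_cases hz : z ∈ S
  · rw [indicator_of_mem hz]
  · rw [image_eq_zero_of_notMem_tsupport fun h ↦ hz (hφ.support_subset h), mul_zero, mul_zero]

theorem IsTestFunction.indicator_mul_fderiv {S : Set X} {φ : X → ℝ} (hφ : IsTestFunction S φ)
    (f : X → ℝ) (z e : X) : S.indicator f z * fderiv ℝ φ z e = f z * fderiv ℝ φ z e := by
  by_cases hz : z ∈ S
  · rw [indicator_of_mem hz]
  · rw [fderiv_of_notMem_tsupport (𝕜 := ℝ) fun h ↦ hz (hφ.support_subset h)]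
    simp

variable [MeasureSpace X] {c : ℝ≥0∞}

theorem memLp_indicator_comp (hc : c ≠ ⊤)
    (hΦ : MeasurePreserving (fun z ↦ z₀ + L z) volume (c • (volume : Measure X)))
    {K S : Set X} (hK : MeasurableSet K) (hS : MeasurableSet S)
    (hSK : MapsTo (fun z ↦ z₀ + L z) S K) {f : X → ℝ} {q : ℝ≥0∞}
    (hf : MemLp f q (volume.restrict K)) :
    MemLp (S.indicator fun z ↦ f (z₀ + L z)) q := by
  have h1 := (((memLp_indicator_iff_restrict hK).2 hf).smul_measure
    hc).comp_measurePreserving hΦ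
  have h2 : S.indicator (K.indicator f ∘ fun z ↦ z₀ + L z) = S.indicator fun z ↦ f (z₀ + L z) :=
    indicator_congr fun z hz ↦ indicator_of_mem (hSK hz) f
  exact h2 ▸ h1.indicator hS

theorem ae_imp_comp
    (hΦ : MeasurePreserving (fun z ↦ z₀ + L z) volume (c • (volume : Measure X)))
    {K S : Set X} (hK : MeasurableSet K)
    (hSK : MapsTo (fun z ↦ z₀ + L z) S K) {P : X → Prop}
    (hP : ∀ᵐ y ∂(volume.restrict K), P y) : ∀ᵐ z, z ∈ S → P (z₀ + L z) := by
  have h1 : ∀ᵐ y ∂(c • (volume : Measure X)), y ∈ K → P y :=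
    Measure.ae_smul_measure ((ae_restrict_iff' hK).1 hP) c
  filter_upwards [hΦ.quasiMeasurePreserving.ae h1] with z hz hzS
  exact hz (hSK hzS)

variable [BorelSpace X]

theorem integral_comp_add_linearEquiv
    (hΦ : MeasurePreserving (fun z ↦ z₀ + L z) volume (c • (volume : Measure X))) (F : X → ℝ) :
    ∫ z, F (z₀ + L z) = c.toReal * ∫ y, F y := by
  have he : MeasurableEmbedding fun z ↦ z₀ + L z :=
    (L.toHomeomorph.trans (Homeomorph.addLeft z₀)).measurableEmbedding
  rw [hΦ.integral_comp he F, integral_smul_measure, smul_eq_mul]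

end ChangeOfVariables

section FluxIntegrability

variable {X : Type*} [MeasurableSpace X] {μ : Measure X}

theorem memLp_flux_of_memLp {q δ Λ : ℝ} (hq : 1 < q) (hδ : 0 ≤ δ) (hΛ : 1 ≤ Λ) {a g : X → ℝ}
    (ha : AEMeasurable a μ) (haΛ : ∀ᵐ z ∂μ, Λ⁻¹ ≤ a z ∧ a z ≤ Λ)
    (hg : MemLp g (ENNReal.ofReal q) μ) :
    MemLp (fun z ↦ a z * degenerateFlux q δ (g z)) (ENNReal.ofReal q.conjExponent) μ := by
  have hq1 : 0 < q - 1 := sub_pos.2 hq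
  have h1 := hg.norm_rpow_div (ENNReal.ofReal (q - 1))
  rw [← ENNReal.ofReal_div_of_pos hq1, ENNReal.toReal_ofReal hq1.le] at h1
  refine h1.of_le_mul (c := Λ) (ha.mul ((measurable_degenerateFlux q δ).comp_aemeasurable
    hg.1.aemeasurable)).aestronglyMeasurable ?_
  filter_upwards [haΛ] with z hz
  have ha0 : 0 < a z := (inv_pos.2 (by linarith)).trans_le hz.1
  rw [norm_mul, Real.norm_eq_abs, Real.norm_eq_abs, abs_of_pos ha0,
    Real.norm_of_nonneg (Real.rpow_nonneg (norm_nonneg _) _)]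
  exact mul_le_mul hz.2 (abs_degenerateFlux_le hq hδ _) (abs_nonneg _) (by linarith)

end FluxIntegrability

variable {n : ℕ} {Ω : Set (EuclideanSpace ℝ (Fin n))} {T : ℝ}

/-- With `r_i ^ p_i = τ`, multiplying the weak form by `τ` gives the flux the weight `τ / r_i = r_i
^ (p_i - 1)`, which is that of the same equation with thresholds `r_i δ_i`. The values of `u` are
not rescaled, so `m`, `M` and `C₀` do not depend on the cylinder. The signs of `m` and `C₀` make the
extension by zero harmless. -/
theorem isBallSupersolution_dilation {p δ : Fin n → ℝ} {a : Fin n → EuclideanSpace ℝ (Fin n) × ℝ → ℝ}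
    {Λ : ℝ} {u : EuclideanSpace ℝ (Fin n) × ℝ → ℝ} {g : Fin n → EuclideanSpace ℝ (Fin n) × ℝ → ℝ}
    (hp : ∀ i, 1 < p i) (hδ : ∀ i, 0 ≤ δ i) (hΛ : 1 ≤ Λ)
    (ha_meas : ∀ i, AEMeasurable (a i) (volume.restrict (cylinder Ω T)))
    (ha : ∀ i, ∀ᵐ z ∂(volume.restrict (cylinder Ω T)), Λ⁻¹ ≤ a i z ∧ a i z ≤ Λ)
    (hu : MemParabolicSobolevLoc Ω T p u g)
    (hweak : ∀ φ : EuclideanSpace ℝ (Fin n) × ℝ → ℝ, IsTestFunction (cylinder Ω T) φ →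
      (∀ z, 0 ≤ φ z) → weakForm Ω T p δ a u g φ ≤ 0)
    {r : Fin n → ℝ} {τ : ℝ} (hr : ∀ i, 0 < r i) (hr1 : ∀ i, r i ≤ 1) (hτ : 0 < τ)
    (hrτ : ∀ i, r i ^ p i = τ) {z₀ : EuclideanSpace ℝ (Fin n) × ℝ}
    {K : Set (EuclideanSpace ℝ (Fin n) × ℝ)} (hK : IsCompact K) (hKc : K ⊆ cylinder Ω T)
    (hΦK : MapsTo (fun z ↦ z₀ + dilation r τ (fun i ↦ (hr i).ne') hτ.ne' z) (ball 0 2) K)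
    {m M C₀ : ℝ} (hm0 : m ≤ 0) (hm : ∀ᵐ z ∂(volume.restrict K), m ≤ u z) (hC₀ : 0 ≤ C₀)
    (hcoer : ∀ i, ∀ η, η ≤ δ i → 0 ≤ η → ∀ b, Λ⁻¹ ≤ b → b ≤ Λ → ∀ s : ℝ,
      |s| + 2 * M * |b * degenerateFlux (p i) η s| ≤ b * degenerateFlux (p i) η s * s + C₀) :
    IsBallSupersolution p
      ((ball 0 2).indicator fun z ↦ u (z₀ + dilation r τ (fun i ↦ (hr i).ne') hτ.ne' z))
      (fun i ↦ (ball 0 2).indicator fun z ↦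
        r i * g i (z₀ + dilation r τ (fun i ↦ (hr i).ne') hτ.ne' z))
      (fun i ↦ (ball 0 2).indicator fun z ↦ r i ^ (p i - 1) *
        (a i (z₀ + dilation r τ (fun i ↦ (hr i).ne') hτ.ne' z) * degenerateFlux (p i) (δ i)
          (g i (z₀ + dilation r τ (fun i ↦ (hr i).ne') hτ.ne' z)))) m M C₀ := by
  set L := dilation r τ (fun i ↦ (hr i).ne') hτ.ne' with hL
  obtain ⟨c, hc0, hct, hΦ⟩ := exists_measurePreserving_add_linearEquiv volume L z₀
  have hKm := hK.measurableSet
  have hSm : MeasurableSet (ball (0 : EuclideanSpace ℝ (Fin n) × ℝ) 2) := measurableSet_ball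
  have : IsFiniteMeasure ((volume : Measure (EuclideanSpace ℝ (Fin n) × ℝ)).restrict K) :=
    isFiniteMeasure_restrict.2 hK.measure_lt_top.ne
  have haK : ∀ i, ∀ᵐ z ∂(volume.restrict K), Λ⁻¹ ≤ a i z ∧ a i z ≤ Λ := fun i ↦
    ae_restrict_of_ae_restrict_of_subset hKc (ha i)
  have hflux : ∀ i, MemLp (fun y ↦ a i y * degenerateFlux (p i) (δ i) (g i y))
      (ENNReal.ofReal (p i).conjExponent) (volume.restrict K) := fun i ↦
    memLp_flux_of_memLp (hp i) (hδ i) hΛ ((ha_meas i).mono_set hKc) (haK i)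
      (hu.grad_memLpLoc i K hK hKc)
  have hflux1 : ∀ i, MemLp (fun y ↦ a i y * degenerateFlux (p i) (δ i) (g i y)) 1
      (volume.restrict K) := fun i ↦ (hflux i).mono_exponent (by
    simpa using (Real.HolderConjugate.conjExponent (hp i)).symm.lt.le)
  have hone : ∀ {f : EuclideanSpace ℝ (Fin n) × ℝ → ℝ}, MemLpLoc f 1 (cylinder Ω T) →
      MemLp f 1 (volume.restrict K) := fun {f} hf ↦ by
    simpa using hf K hK hKc
  have hmul : ∀ (b : ℝ) (f : EuclideanSpace ℝ (Fin n) × ℝ → ℝ),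
      ((ball 0 2).indicator fun z ↦ b * f (z₀ + L z))
        = fun z ↦ b * (ball 0 2).indicator (fun z ↦ f (z₀ + L z)) z := fun b f ↦
    funext fun z ↦ indicator_const_mul _ _ _ z
  have htrans : ∀ {f : EuclideanSpace ℝ (Fin n) × ℝ → ℝ} {q : ℝ≥0∞},
      MemLp f q (volume.restrict K) → MemLp ((ball 0 2).indicator fun z ↦ f (z₀ + L z)) q :=
    fun {f q} hf ↦ memLp_indicator_comp hct hΦ hKm hSm hΦK hf
  have hcyl : MapsTo (fun z ↦ z₀ + L z) (ball 0 2) (cylinder Ω T) := hΦK.mono_right hKc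
  have hLt : L.symm (0, 1) = τ⁻¹ • (0, 1) := dilation_symm_time _ _
  have hLs : ∀ i, L.symm (EuclideanSpace.single i 1, 0)
      = (r i)⁻¹ • (EuclideanSpace.single i 1, 0) := dilation_symm_single _ _
  constructor
  · exact memLp_one_iff_integrable.1 (htrans (hone hu.memLpLoc_one))
  · intro i
    rw [hmul]
    exact (memLp_one_iff_integrable.1 (htrans (hone (hu.grad_memLpLoc_one i)))).const_mul _
  · intro i
    rw [hmul (r i ^ (p i - 1)) fun y ↦ a i y * degenerateFlux (p i) (δ i) (g i y)]
    exact (memLp_one_iff_integrable.1 (htrans (hflux1 i))).const_mul _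
  · intro i
    rw [hmul]
    exact (htrans (hu.grad_memLpLoc i K hK hKc)).const_mul _
  · intro i
    rw [hmul (r i ^ (p i - 1)) fun y ↦ a i y * degenerateFlux (p i) (δ i) (g i y)]
    exact (htrans (hflux i)).const_mul _
  · intro φ hφ hφ0
    have hφ1 : ContDiff ℝ 1 φ := hφ.smooth.of_le (by simp)
    have hψ := hφ.comp_affine_symm hcyl
    have h1 := hweak _ hψ fun y ↦ hφ0 _
    set ψ : EuclideanSpace ℝ (Fin n) × ℝ → ℝ := fun y ↦ φ (L.symm (y - z₀)) with hψ_def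
    rw [weakForm, setIntegral_eq_integral_of_forall_compl_eq_zero] at h1
    · have h2 := integral_comp_add_linearEquiv hΦ fun y ↦ u y * fderiv ℝ ψ y (0, 1)
        - ∑ i, a i y * degenerateFlux (p i) (δ i) (g i y)
          * fderiv ℝ ψ y (EuclideanSpace.single i 1, 0)
      have h3 := mul_nonpos_of_nonneg_of_nonpos (ENNReal.toReal_nonneg (a := c)) h1
      rw [← h2] at h3
      have h4 := mul_nonpos_of_nonneg_of_nonpos hτ.le h3
      rw [← integral_const_mul] at h4
      refine le_trans (le_of_eq (integral_congr_ae (ae_of_all _ fun z ↦ ?_))) h4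
      simp only [hφ.indicator_mul_fderiv, hψ_def, fderiv_comp_affine_symm hφ1]
      rw [hLt, map_smul, mul_sub, Finset.mul_sum, smul_eq_mul]
      congr 1
      · field_simp
      · refine Finset.sum_congr rfl fun i _ ↦ ?_
        rw [hLs, map_smul, smul_eq_mul, Real.rpow_sub (hr i), hrτ i, Real.rpow_one]
        ring
    · intro y hy
      have : fderiv ℝ ψ y = 0 :=
        fderiv_of_notMem_tsupport (𝕜 := ℝ) fun h ↦ hy (hψ.support_subset h)
      simp [this]
  · intro i φ hφ
    have hφ1 : ContDiff ℝ 1 φ := hφ.smooth.of_le (by simp)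
    have hψ := hφ.comp_affine_symm hcyl
    have h1 := hu.setIntegral_mul_fderiv i hψ
    set ψ : EuclideanSpace ℝ (Fin n) × ℝ → ℝ := fun y ↦ φ (L.symm (y - z₀)) with hψ_def
    rw [setIntegral_eq_integral_of_forall_compl_eq_zero,
      setIntegral_eq_integral_of_forall_compl_eq_zero] at h1
    · have h2 := integral_comp_add_linearEquiv hΦ fun y ↦
        u y * fderiv ℝ ψ y (EuclideanSpace.single i 1, 0)
      have h3 := integral_comp_add_linearEquiv hΦ fun y ↦ g i y * ψ y
      simp only [hφ.indicator_mul_fderiv, hφ.indicator_mul]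
      have h4 : ∫ z, u (z₀ + L z) * fderiv ℝ φ z (EuclideanSpace.single i 1, 0)
          = r i * ∫ z, u (z₀ + L z) * fderiv ℝ ψ (z₀ + L z) (EuclideanSpace.single i 1, 0) := by
        rw [← integral_const_mul]
        refine integral_congr_ae (ae_of_all _ fun z ↦ ?_)
        simp only [hψ_def, fderiv_comp_affine_symm hφ1]
        rw [hLs, map_smul, smul_eq_mul]
        have := (hr i).ne'
        field_simp
      have h5 : ∫ z, r i * g i (z₀ + L z) * φ z
          = r i * ∫ z, g i (z₀ + L z) * ψ (z₀ + L z) := by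
        rw [← integral_const_mul]
        refine integral_congr_ae (ae_of_all _ fun z ↦ ?_)
        simp [hψ_def, mul_assoc]
      rw [h4, h5, h2, h3, h1]
      ring
    · intro y hy
      change g i y * ψ y = 0
      rw [image_eq_zero_of_notMem_tsupport fun h ↦ hy (hψ.support_subset h), mul_zero]
    · intro y hy
      rw [fderiv_of_notMem_tsupport (𝕜 := ℝ) fun h ↦ hy (hψ.support_subset h)]
      simp
  · filter_upwards [ae_imp_comp hΦ hKm hΦK hm] with z hz
    by_cases hzS : z ∈ ball (0 : EuclideanSpace ℝ (Fin n) × ℝ) 2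
    · rw [indicator_of_mem hzS]
      exact hz hzS
    · rwa [indicator_of_notMem hzS]
  · rw [ae_all_iff]
    intro i
    filter_upwards [ae_imp_comp hΦ hKm hΦK (haK i)] with z hz
    by_cases hzS : z ∈ ball (0 : EuclideanSpace ℝ (Fin n) × ℝ) 2
    · simp only [indicator_of_mem hzS]
      -- Coercivity is used at the rescaled threshold and rescaled gradient, then rewritten through
      -- homogeneity.
      have h1 := hcoer i (r i * δ i) (mul_le_of_le_one_left (hδ i) (hr1 i))
        (mul_nonneg (hr i).le (hδ i)) _ (hz hzS).1 (hz hzS).2 (r i * g i (z₀ + L z))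
      rw [degenerateFlux_mul _ _ _ (hr i), mul_left_comm] at h1
      exact h1
    · simpa only [indicator_of_notMem hzS, abs_zero, mul_zero, add_zero, zero_add] using hC₀


/-! ### An averaging substitute for Lebesgue density -/

section Translation

variable {X : Type*} [NormedAddCommGroup X] [NormedSpace ℝ X] [FiniteDimensional ℝ X]
  [MeasurableSpace X] [BorelSpace X] {μ : Measure X} [μ.IsAddHaarMeasure]

/-- If `F` does not meet the compact set `A` of positive measure, then some point `z₀` of `A` sees
little of `F` through a map of small size. -/
theorem exists_measure_setOf_add_mem_le {A F B : Set X} (hA : IsCompact A) (hA0 : μ A ≠ 0)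
    (hF : NullMeasurableSet F μ) (hAF : A ∩ F = ∅) (hB : MeasurableSet B) (hBfin : μ B ≠ ⊤)
    {ν : ℝ≥0∞} (hν : 0 < ν) : ∃ ε : ℝ, 0 < ε ∧ ∀ L : X → X, Continuous L →
      (∀ z ∈ B, ‖L z‖ < ε) → ∃ z₀ ∈ A, μ {z ∈ B | z₀ + L z ∈ F} ≤ ν := by
  obtain ⟨F', hFF', hF'm, hF'ae⟩ := hF.exists_measurable_superset_ae_eq
  have hAF' : μ (A ∩ F') = 0 := by
    rw [measure_congr ((ae_eq_refl A).inter hF'ae), hAF, measure_empty]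
  -- The excess of an open neighbourhood `O` over `A` will be smaller than this, so that `μ (O ∩ F')
  -- * μ B < ν * μ A`; the `+ 1` covers the case `μ B = 0`.
  have hη : ν * μ A / (μ B + 1) ≠ 0 :=
    (ENNReal.div_pos (mul_ne_zero hν.ne' hA0) (by simp [hBfin])).ne'
  obtain ⟨O, hAO, hO, hμO⟩ := A.exists_isOpen_lt_add (μ := μ) hA.measure_lt_top.ne hη
  have hOF : μ (O ∩ F') < ν * μ A / (μ B + 1) := by
    have h1 : μ (O ∩ F') ≤ μ (O \ A) := by
      calc μ (O ∩ F') ≤ μ ((O \ A) ∪ (A ∩ F')) := measure_mono fun z hz ↦ by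
            by_cases hzA : z ∈ A
            · exact Or.inr ⟨hzA, hz.2⟩
            · exact Or.inl ⟨hz.1, hzA⟩
        _ ≤ μ (O \ A) + μ (A ∩ F') := measure_union_le _ _
        _ = μ (O \ A) := by rw [hAF', add_zero]
    refine h1.trans_lt ?_
    rw [measure_sdiff hAO hA.measurableSet.nullMeasurableSet hA.measure_lt_top.ne]
    exact ENNReal.sub_lt_of_lt_add (measure_mono hAO) (by rwa [add_comm])
  obtain ⟨ε, hε, hεO⟩ := hA.exists_thickening_subset_open hO hAO
  refine ⟨ε, hε, fun L hL hLε ↦ ?_⟩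
  by_contra! hcon
  have hmeas : Measurable fun q : X × X ↦ F'.indicator (fun _ ↦ (1 : ℝ≥0∞)) (q.1 + L q.2) :=
    (measurable_const.indicator hF'm).comp
      (measurable_fst.add (hL.measurable.comp measurable_snd))
  -- If every centre in `A` were bad, the double integral would be at least `ν μ(A)`. Integrating
  -- first over the centres, whose translates by `L z` stay in `O`, gives the contradictory bound
  -- `μ(O ∩ F') μ(B)`.
  have h1 : ν * μ A ≤ ∫⁻ y in A, ∫⁻ z in B, F'.indicator (fun _ ↦ (1 : ℝ≥0∞)) (y + L z) ∂μ ∂μ := by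
    rw [← setLIntegral_const]
    refine setLIntegral_mono' hA.measurableSet fun y hy ↦ (hcon y hy).le.trans ?_
    have hm : MeasurableSet {z | y + L z ∈ F'} :=
      (measurable_const.add hL.measurable) hF'm
    calc μ {z ∈ B | y + L z ∈ F} ≤ μ ({z | y + L z ∈ F'} ∩ B) :=
          measure_mono fun z hz ↦ ⟨hFF' hz.2, hz.1⟩
      _ = ∫⁻ z in B, {z | y + L z ∈ F'}.indicator (fun _ ↦ (1 : ℝ≥0∞)) z ∂μ := by
          rw [lintegral_indicator_const hm, one_mul, Measure.restrict_apply hm]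
      _ = _ := rfl
  rw [lintegral_lintegral_swap hmeas.aemeasurable] at h1
  have h2 : ∫⁻ z in B, ∫⁻ y in A, F'.indicator (fun _ ↦ (1 : ℝ≥0∞)) (y + L z) ∂μ ∂μ
      ≤ μ (O ∩ F') * μ B := by
    rw [← setLIntegral_const]
    refine setLIntegral_mono' hB fun z hz ↦ ?_
    have hm : MeasurableSet {y | y + L z ∈ F'} := (measurable_id.add_const _) hF'm
    calc ∫⁻ y in A, F'.indicator (fun _ ↦ (1 : ℝ≥0∞)) (y + L z) ∂μ
        = ∫⁻ y in A, {y | y + L z ∈ F'}.indicator (fun _ ↦ (1 : ℝ≥0∞)) y ∂μ := rfl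
      _ = μ ({y | y + L z ∈ F'} ∩ A) := by
          rw [lintegral_indicator_const hm, one_mul, Measure.restrict_apply hm]
      _ ≤ μ ((fun y ↦ y + L z) ⁻¹' (O ∩ F')) := by
          refine measure_mono fun y hy ↦ ⟨hεO ?_, hy.1⟩
          rw [mem_thickening_iff]
          exact ⟨y, hy.2, by simpa [dist_eq_norm] using hLε z hz⟩
      _ = μ (O ∩ F') := measure_preimage_add_right _ _ _
  have h3 : μ (O ∩ F') * μ B ≤ μ (O ∩ F') * (μ B + 1) := by gcongr; exact le_self_add
  have h4 : μ (O ∩ F') * (μ B + 1) < ν * μ A :=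
    (ENNReal.lt_div_iff_mul_lt (Or.inl (by simp)) (Or.inl (by simp [hBfin]))).1 hOF
  exact absurd (h1.trans (h2.trans h3)) (not_le.2 h4)

end Translation

/-! ### Construction of the semicontinuous representative -/

section Representative

variable {X : Type*} [TopologicalSpace X] [MeasureSpace X]

/-- The open set of points near which `c ≤ u` almost everywhere. -/
def essGeSet (u : X → ℝ) (c : ℝ) : Set X :=
  {z | ∃ V, IsOpen V ∧ z ∈ V ∧ ∀ᵐ y ∂(volume.restrict V), c ≤ u y}

theorem isOpen_essGeSet (u : X → ℝ) (c : ℝ) : IsOpen (essGeSet u c) := by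
  rw [isOpen_iff_forall_mem_open]
  rintro z ⟨V, hV, hzV, hVc⟩
  exact ⟨V, fun y hy ↦ ⟨V, hV, hy, hVc⟩, hV, hzV⟩

variable [OpensMeasurableSpace X] [SecondCountableTopology X]

theorem ae_le_of_mem_essGeSet (u : X → ℝ) (c : ℝ) : ∀ᵐ z, z ∈ essGeSet u c → c ≤ u z := by
  rw [ae_iff]
  refine measure_null_of_locally_null _ fun z hz ↦ ?_
  have hz' : z ∈ essGeSet u c := by
    by_contra h
    exact hz fun h' ↦ absurd h' h
  obtain ⟨V, hV, hzV, hVc⟩ := hz'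
  rw [ae_restrict_iff' hV.measurableSet, ae_iff] at hVc
  refine ⟨_, inter_mem_nhdsWithin _ (hV.mem_nhds hzV), measure_mono_null ?_ hVc⟩
  rintro y ⟨hy, hyV⟩ h
  exact hy fun _ ↦ h hyV

/-- The representative is the supremum of the rational `c` with `z ∈ essGeSet u c`, semicontinuous
because these sets are open. It is at most `u` almost everywhere by `ae_le_of_mem_essGeSet`; the
null-set hypothesis excludes a rational gap between it and `u`. Rational levels keep the exceptional
sets countable in number. -/
theorem hasLscRepresentative_of_null [LocallyCompactSpace X] {u : X → ℝ} {S : Set X}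
    (hS : IsOpen S) (hbdd : LocallyBddBelow u S)
    (hnull : ∀ c d : ℝ, c < d → volume {z ∈ S | d < u z ∧ z ∉ essGeSet u c} = 0) :
    HasLscRepresentative u S := by
  refine ⟨fun z ↦ ⨆ (c : ℚ) (_ : z ∈ essGeSet u c), ((c : ℝ) : EReal), ?_, ?_, ?_⟩
  · intro z _ y hy
    obtain ⟨c, hc⟩ := lt_iSup_iff.1 hy
    obtain ⟨hzc, hyc⟩ := lt_iSup_iff.1 hc
    filter_upwards [mem_nhdsWithin_of_mem_nhds ((isOpen_essGeSet u c).mem_nhds hzc)] with x hx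
    exact hyc.trans_le (le_iSup₂ (f := fun (c : ℚ) (_ : x ∈ essGeSet u c) ↦ ((c : ℝ) : EReal)) c hx)
  · intro z hz
    obtain ⟨K, hK, hzK, hKS⟩ := exists_compact_subset hS hz
    obtain ⟨m, hm⟩ := hbdd K hK hKS
    obtain ⟨c, hc⟩ := exists_rat_lt m
    have hzc : z ∈ essGeSet u c := ⟨interior K, isOpen_interior, hzK, by
      filter_upwards [ae_restrict_of_ae_restrict_of_subset interior_subset hm] with y hy
      exact hc.le.trans hy⟩
    refine ne_of_gt ((EReal.bot_lt_coe c).trans_le ?_)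
    exact le_iSup₂ (f := fun (c : ℚ) (_ : z ∈ essGeSet u c) ↦ ((c : ℝ) : EReal)) c hzc
  · rw [ae_restrict_iff' hS.measurableSet]
    have h1 : ∀ᵐ z, ∀ c : ℚ, z ∈ essGeSet u c → (c : ℝ) ≤ u z :=
      ae_all_iff.2 fun c ↦ ae_le_of_mem_essGeSet u c
    have h2 : ∀ᵐ z, ∀ c d : ℚ, c < d → ¬(z ∈ S ∧ (d : ℝ) < u z ∧ z ∉ essGeSet u c) :=
      ae_all_iff.2 fun c ↦ ae_all_iff.2 fun d ↦ by
        by_cases hcd : c < d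
        · have := hnull c d (by exact_mod_cast hcd)
          filter_upwards [measure_eq_zero_iff_ae_notMem.1 this] with z hz _
          exact hz
        · exact ae_of_all _ fun z h ↦ absurd h hcd
    filter_upwards [h1, h2] with z hz1 hz2 hzS
    refine le_antisymm (iSup₂_le fun c hc ↦ EReal.coe_le_coe_iff.2 (hz1 c hc)) ?_
    by_contra! hlt
    obtain ⟨d, hd1, hd2⟩ := EReal.lt_iff_exists_rat_btwn.1 hlt
    obtain ⟨c, hc1, hc2⟩ := EReal.lt_iff_exists_rat_btwn.1 hd1
    refine hz2 c d (by exact_mod_cast hc2) ⟨hzS, by exact_mod_cast hd2, fun hzc ↦ ?_⟩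
    refine absurd hc1 (not_lt.2 ?_)
    exact le_iSup₂ (f := fun (c : ℚ) (_ : z ∈ essGeSet u c) ↦ ((c : ℝ) : EReal)) c hzc

end Representative

theorem HasLscRepresentative.neg {X : Type*} [TopologicalSpace X] [MeasureSpace X] {u : X → ℝ}
    {S : Set X} (h : HasLscRepresentative (fun z ↦ -u z) S) : HasUscRepresentative u S := by
  obtain ⟨v, hv, hbot, hae⟩ := h
  refine ⟨fun z ↦ -v z, ?_, fun z hz ↦ ?_, ?_⟩
  · intro z hz y hy
    filter_upwards [hv z hz (-y) (EReal.neg_lt_of_neg_lt hy)] with x hx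
    exact EReal.neg_lt_of_neg_lt hx
  · rw [Ne, EReal.neg_eq_top_iff]
    exact hbot z hz
  · filter_upwards [hae] with z hz
    rw [hz]
    simp


/-! ### Subsolutions by negation -/

section Negation

variable {n : ℕ} {Ω : Set (EuclideanSpace ℝ (Fin n))} {T : ℝ} {p δ : Fin n → ℝ}
  {a : Fin n → EuclideanSpace ℝ (Fin n) × ℝ → ℝ} {u : EuclideanSpace ℝ (Fin n) × ℝ → ℝ}
  {g : Fin n → EuclideanSpace ℝ (Fin n) × ℝ → ℝ}

theorem MemLpLoc.neg {X : Type*} [TopologicalSpace X] [MeasureSpace X] {f : X → ℝ} {q : ℝ}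
    {S : Set X} (h : MemLpLoc f q S) : MemLpLoc (fun x ↦ -f x) q S :=
  fun K hK hKS ↦ (h K hK hKS).neg

theorem MemW11Loc.neg {f : EuclideanSpace ℝ (Fin n) → ℝ}
    {g : Fin n → EuclideanSpace ℝ (Fin n) → ℝ} (h : MemW11Loc Ω f g) :
    MemW11Loc Ω (fun x ↦ -f x) (fun i x ↦ -g i x) where
  memLpLoc := h.memLpLoc.neg
  grad_memLpLoc i := (h.grad_memLpLoc i).neg
  integral_eq i φ hφ := by
    simp only [neg_mul, integral_neg, h.integral_eq i φ hφ]

theorem MemParabolicSobolevLoc.neg (h : MemParabolicSobolevLoc Ω T p u g) :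
    MemParabolicSobolevLoc Ω T p (fun z ↦ -u z) (fun i z ↦ -g i z) where
  memLpLoc_one := h.memLpLoc_one.neg
  grad_memLpLoc_one i := (h.grad_memLpLoc_one i).neg
  slice := h.slice.mono fun _ ht ↦ ht.neg
  grad_memLpLoc i := (h.grad_memLpLoc i).neg

theorem weakForm_neg (φ : EuclideanSpace ℝ (Fin n) × ℝ → ℝ) :
    weakForm Ω T p δ a (fun z ↦ -u z) (fun i z ↦ -g i z) φ = -weakForm Ω T p δ a u g φ := by
  rw [weakForm, weakForm, ← integral_neg]
  congr 1
  ext z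
  simp only [degenerateFlux_neg, mul_neg, neg_mul, Finset.sum_neg_distrib]
  ring

theorem IsLocalWeakSubsolution.neg (h : IsLocalWeakSubsolution Ω T p δ a u) :
    IsLocalWeakSupersolution Ω T p δ a fun z ↦ -u z := by
  obtain ⟨h1, g, hg, hw⟩ := h
  exact ⟨h1.neg, _, hg.neg, fun φ hφ hφ0 ↦ by
    rw [weakForm_neg]
    exact neg_nonpos.2 (hw φ hφ hφ0)⟩

theorem LocallyBddAbove.neg {X : Type*} [TopologicalSpace X] [MeasureSpace X] {f : X → ℝ}
    {S : Set X} (h : LocallyBddAbove f S) : LocallyBddBelow (fun x ↦ -f x) S := fun K hK hKS ↦ by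
  obtain ⟨m, hm⟩ := h K hK hKS
  exact ⟨-m, hm.mono fun _ hx ↦ neg_le_neg hx⟩

end Negation

/-! ### Lower bounds at small scales and conclusion -/

variable {n : ℕ} {Ω : Set (EuclideanSpace ℝ (Fin n))} {T : ℝ} {p δ : Fin n → ℝ}
  {a : Fin n → EuclideanSpace ℝ (Fin n) × ℝ → ℝ} {Λ : ℝ}
  {u : EuclideanSpace ℝ (Fin n) × ℝ → ℝ} {g : Fin n → EuclideanSpace ℝ (Fin n) × ℝ → ℝ}

theorem exists_rpow_radii (hp : ∀ i, 1 < p i) {ρ : ℝ} (hρ0 : 0 < ρ) (hρ1 : ρ ≤ 1) :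
    ∃ (τ : ℝ) (r : Fin n → ℝ), 0 < τ ∧ τ ≤ ρ ∧ (∀ i, 0 < r i) ∧ (∀ i, r i ≤ ρ) ∧
      ∀ i, r i ^ p i = τ := by
  have hp0 : ∀ i, 0 < p i := fun i ↦ by linarith [hp i]
  -- Any `P ≥ 1` bounding all the `p_i` would do: `τ = ρ ^ P` and `r_i = ρ ^ (P / p_i)` are then at
  -- most `ρ`.
  set P : ℝ := 1 + ∑ i, p i with hP
  have hPi : ∀ i, p i ≤ P := fun i ↦ by
    have := Finset.single_le_sum (f := p) (fun j _ ↦ (hp0 j).le) (Finset.mem_univ i)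
    linarith
  have hP1 : 1 ≤ P := by
    have := Finset.sum_nonneg (s := Finset.univ) fun i _ ↦ (hp0 i).le
    linarith
  have hle : ∀ e : ℝ, 1 ≤ e → ρ ^ e ≤ ρ := fun e he ↦ by
    simpa using Real.rpow_le_rpow_of_exponent_ge hρ0 hρ1 he
  refine ⟨ρ ^ P, fun i ↦ ρ ^ (P / p i), by positivity, hle P hP1, fun i ↦ by positivity,
    fun i ↦ hle _ ?_, fun i ↦ ?_⟩
  · rw [le_div_iff₀ (hp0 i), one_mul]
    exact hPi i
  · rw [← Real.rpow_mul hρ0.le, div_mul_cancel₀ _ (hp0 i).ne']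

/-- The uniform De Giorgi lemma in anisotropic cylinders: if `u < d` only on a small proportion of
a small cylinder around `z₀`, then `c ≤ u` near `z₀`. -/
theorem exists_mem_essGeSet_of_measure_le (hn : 2 ≤ n) (hp : ∀ i, 1 < p i) (hδ : ∀ i, 0 ≤ δ i)
    (hΛ : 1 ≤ Λ) (ha_meas : ∀ i, AEMeasurable (a i) (volume.restrict (cylinder Ω T)))
    (ha : ∀ i, ∀ᵐ z ∂(volume.restrict (cylinder Ω T)), Λ⁻¹ ≤ a i z ∧ a i z ≤ Λ)
    (hu : MemParabolicSobolevLoc Ω T p u g)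
    (hweak : ∀ φ : EuclideanSpace ℝ (Fin n) × ℝ → ℝ, IsTestFunction (cylinder Ω T) φ →
      (∀ z, 0 ≤ φ z) → weakForm Ω T p δ a u g φ ≤ 0)
    {K : Set (EuclideanSpace ℝ (Fin n) × ℝ)} (hK : IsCompact K) (hKc : K ⊆ cylinder Ω T)
    {m : ℝ} (hm : ∀ᵐ z ∂(volume.restrict K), m ≤ u z) {c d : ℝ} (hcd : c < d) :
    ∃ ν : ℝ≥0∞, 0 < ν ∧ ∀ (r : Fin n → ℝ) (τ : ℝ) (hr : ∀ i, 0 < r i) (hτ : 0 < τ),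
      (∀ i, r i ≤ 1) → (∀ i, r i ^ p i = τ) → ∀ z₀,
      MapsTo (fun z ↦ z₀ + dilation r τ (fun i ↦ (hr i).ne') hτ.ne' z) (ball 0 2) K →
      volume {z ∈ closedBall (0 : EuclideanSpace ℝ (Fin n) × ℝ) 1 |
        u (z₀ + dilation r τ (fun i ↦ (hr i).ne') hτ.ne' z) < d} ≤ ν → z₀ ∈ essGeSet u c := by
  -- A lower bound that is nonpositive, so that the extension by zero respects it, and at most `d -
  -- 1`, so that `M > 0`. With `M = d - m'` the level `k = d` is exactly the admissible `m' + M`.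
  set m' : ℝ := min m (min 0 (d - 1)) with hm'
  set M : ℝ := d - m' with hM
  have hm'0 : m' ≤ 0 := (min_le_right _ _).trans (min_le_left _ _)
  have hM0 : 0 < M := by
    have : m' ≤ d - 1 := (min_le_right _ _).trans (min_le_right _ _)
    linarith
  have hC := fun i ↦ exists_abs_add_le_flux_mul (hp i) (hδ i) hΛ (c := 2 * M) (by positivity)
  choose C hC0 hC using hC
  set C₀ : ℝ := ∑ i, C i with hC₀
  have hCi : ∀ i, C i ≤ C₀ := fun i ↦
    Finset.single_le_sum (f := C) (fun j _ ↦ hC0 j) (Finset.mem_univ i)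
  have hC₀0 : 0 ≤ C₀ := Finset.sum_nonneg fun i _ ↦ hC0 i
  obtain ⟨ν, hν, s, hs, H⟩ := IsBallSupersolution.exists_ae_le_of_measure_le (p := p) hn hp hM0 hC₀0
    (d := (d - c) / 2) (by linarith)
  refine ⟨ν, hν, fun r τ hr hτ hr1 hrτ z₀ hmaps hle ↦ ?_⟩
  have hball := isBallSupersolution_dilation hp hδ hΛ ha_meas ha hu hweak hr hr1 hτ hrτ hK hKc
    hmaps hm'0 (hm.mono fun z hz ↦ (min_le_left _ _).trans hz) hC₀0 (M := M)
    fun i η hη hη0 b hb1 hb2 x ↦ (hC i η hη hη0 b hb1 hb2 x).trans (by linarith [hCi i])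
  set L := dilation r τ (fun i ↦ (hr i).ne') hτ.ne' with hL
  have hsub : {z ∈ closedBall (0 : EuclideanSpace ℝ (Fin n) × ℝ) 1 |
      (ball 0 2).indicator (fun z ↦ u (z₀ + L z)) z < d}
      ⊆ {z ∈ closedBall (0 : EuclideanSpace ℝ (Fin n) × ℝ) 1 | u (z₀ + L z) < d} := by
    rintro z ⟨hz1, hz2⟩
    refine ⟨hz1, ?_⟩
    rwa [indicator_of_mem (closedBall_subset_ball one_lt_two hz1)] at hz2
  have hae := H hball (k := d) (by linarith) ((measure_mono hsub).trans hle)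
  obtain ⟨q, hq0, hqt, hΦ⟩ := exists_measurePreserving_add_linearEquiv volume L z₀
  set e : (EuclideanSpace ℝ (Fin n) × ℝ) ≃ₜ (EuclideanSpace ℝ (Fin n) × ℝ) :=
    L.toHomeomorph.trans (Homeomorph.addLeft z₀) with he
  set W := ball (0 : EuclideanSpace ℝ (Fin n) × ℝ) (min s 2) with hW
  have hVo : IsOpen (e '' W) := e.isOpenMap _ isOpen_ball
  refine ⟨e '' W, hVo, ⟨0, mem_ball_self (lt_min hs two_pos), by simp [he]⟩, ?_⟩
  rw [ae_restrict_iff' hVo.measurableSet, ae_iff]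
  -- The bound in rescaled coordinates is transported back through the affine map, which multiplies
  -- measure by a nonzero constant. On `W` the zero extension agrees with `u`.
  have hpre : (fun z ↦ z₀ + L z) ⁻¹' {y | ¬(y ∈ e '' W → c ≤ u y)}
      ⊆ {z | ¬(z ∈ ball 0 s → d - 2 * ((d - c) / 2) ≤
        (ball 0 2).indicator (fun z ↦ u (z₀ + L z)) z)} := by
    intro z hz hcon
    refine hz ?_
    rintro ⟨y, hy, hyz⟩
    have hyz' : y = z := e.injective hyz
    subst hyz'
    have h1 := hcon (ball_subset_ball (min_le_left _ _) hy)
    rw [indicator_of_mem (ball_subset_ball (min_le_right _ _) hy)] at h1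
    linarith
  have h0 := measure_mono_null hpre (ae_iff.1 hae)
  rw [hΦ.measure_preimage_emb e.measurableEmbedding, Measure.smul_apply, smul_eq_mul] at h0
  exact (mul_eq_zero.1 h0).resolve_left hq0

/-- Were the exceptional set of positive measure near some point, a compact part `A` of it would
contain a centre around which `u < d` on only a small proportion of a small cylinder. That centre
would then belong to `essGeSet u c`, which `A` avoids. -/
theorem IsLocalWeakSupersolution.hasLscRepresentative (hn : 2 ≤ n) (hΩ : IsOpen Ω)
    (hp : ∀ i, 1 < p i) (hδ : ∀ i, 0 ≤ δ i)
    (hΛ : 1 ≤ Λ) (ha_meas : ∀ i, AEMeasurable (a i) (volume.restrict (cylinder Ω T)))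
    (ha : ∀ i, ∀ᵐ z ∂(volume.restrict (cylinder Ω T)), Λ⁻¹ ≤ a i z ∧ a i z ≤ Λ)
    (hu : IsLocalWeakSupersolution Ω T p δ a u) (hbdd : LocallyBddBelow u (cylinder Ω T)) :
    HasLscRepresentative u (cylinder Ω T) := by
  obtain ⟨-, g, hg, hweak⟩ := hu
  have hopen : IsOpen (cylinder Ω T) := hΩ.prod isOpen_Ioo
  refine hasLscRepresentative_of_null hopen hbdd fun c d hcd ↦ ?_
  refine measure_null_of_locally_null _ fun z₁ hz₁ ↦ ?_
  obtain ⟨ρ, hρ, hρc⟩ : ∃ ρ : ℝ, 0 < ρ ∧ closedBall z₁ (2 * ρ) ⊆ cylinder Ω T := by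
    obtain ⟨ε, hε, h⟩ := nhds_basis_closedBall.mem_iff.1 (hopen.mem_nhds hz₁.1)
    exact ⟨ε / 2, by positivity, by rwa [mul_div_cancel₀ _ two_ne_zero]⟩
  set K := closedBall z₁ (2 * ρ) with hK_def
  have hK : IsCompact K := isCompact_closedBall _ _
  have hKm : MeasurableSet K := hK.measurableSet
  set K₁ := closedBall z₁ ρ with hK₁
  have hK₁K : K₁ ⊆ K := closedBall_subset_closedBall (by linarith)
  refine ⟨_, inter_mem_nhdsWithin _ (closedBall_mem_nhds z₁ hρ), ?_⟩
  change volume ({z ∈ cylinder Ω T | d < u z ∧ z ∉ essGeSet u c} ∩ K₁) = 0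
  set D := {z ∈ cylinder Ω T | d < u z ∧ z ∉ essGeSet u c} ∩ K₁ with hD
  have hum : AEMeasurable (K.indicator u) volume :=
    (aemeasurable_indicator_iff hKm).2 (hg.memLpLoc_one K hK hρc).1.aemeasurable
  have hDeq : D = (K₁ ∩ (essGeSet u c)ᶜ) ∩ {z | d < K.indicator u z} := by
    ext z
    constructor
    · rintro ⟨⟨-, h1, h2⟩, h3⟩
      refine ⟨⟨h3, h2⟩, ?_⟩
      rwa [mem_ofPred_eq, indicator_of_mem (hK₁K h3)]
    · rintro ⟨⟨h3, h2⟩, h1⟩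
      rw [mem_ofPred_eq, indicator_of_mem (hK₁K h3)] at h1
      exact ⟨⟨hρc (hK₁K h3), h1, h2⟩, h3⟩
  have hDm : NullMeasurableSet D volume := by
    rw [hDeq]
    exact (measurableSet_closedBall.inter
      (isOpen_essGeSet u c).measurableSet.compl).nullMeasurableSet.inter
      (nullMeasurableSet_lt aemeasurable_const hum)
  set F := K ∩ {z | K.indicator u z < d} with hF
  have hFm : NullMeasurableSet F volume :=
    hKm.nullMeasurableSet.inter (nullMeasurableSet_lt hum aemeasurable_const)
  by_contra hD0
  obtain ⟨D', hD'D, hD'm, hD'ae⟩ := hDm.exists_measurable_subset_ae_eq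
  rw [← measure_congr hD'ae] at hD0
  obtain ⟨A, hAD', hA, hA0⟩ := hD'm.exists_lt_isCompact (pos_iff_ne_zero.2 hD0)
  have hAD : A ⊆ D := hAD'.trans hD'D
  have hAF : A ∩ F = ∅ := by
    rw [← disjoint_iff_inter_eq_empty, Set.disjoint_left]
    rintro z hzA ⟨hzK, hzF⟩
    rw [mem_ofPred_eq, indicator_of_mem hzK] at hzF
    exact lt_asymm hzF (hAD hzA).1.2.1
  obtain ⟨m, hm⟩ := hbdd K hK hρc
  obtain ⟨ν, hν, H⟩ := exists_mem_essGeSet_of_measure_le hn hp hδ hΛ ha_meas ha hg hweak hK hρc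
    hm hcd
  obtain ⟨ε, hε, hε'⟩ := exists_measure_setOf_add_mem_le (μ := volume) hA hA0.ne' hFm hAF
    (measurableSet_closedBall (x := (0 : EuclideanSpace ℝ (Fin n) × ℝ)) (ε := 1))
    measure_closedBall_lt_top.ne hν
  -- Then `‖L z‖ < ε` on the closed unit ball, as the averaging lemma requires. The image of the
  -- ball of radius `2` stays within `2σ ≤ ρ` of its centre in `K₁`, hence inside `K`.
  set σ : ℝ := min 1 (min (ρ / 2) (ε / 2)) with hσ
  have hσ0 : 0 < σ := by positivity
  have hσ1 : σ ≤ 1 := min_le_left _ _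
  have hσρ : σ ≤ ρ / 2 := (min_le_right _ _).trans (min_le_left _ _)
  have hσε : σ ≤ ε / 2 := (min_le_right _ _).trans (min_le_right _ _)
  obtain ⟨τ, r, hτ, hτσ, hr, hrσ, hrτ⟩ := exists_rpow_radii hp hσ0 hσ1
  set L := dilation r τ (fun i ↦ (hr i).ne') hτ.ne' with hL
  have hLn : ∀ z, ‖L z‖ ≤ σ * ‖z‖ := norm_dilation_le _ _
    (fun i ↦ by rw [abs_of_pos (hr i)]; exact hrσ i) (by rwa [abs_of_pos hτ])
  obtain ⟨z₀, hz₀, hle⟩ := hε' L L.continuous fun z hz ↦ by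
    have := mem_closedBall_zero_iff.1 hz
    nlinarith [hLn z]
  have hmaps : MapsTo (fun z ↦ z₀ + L z) (ball 0 2) K := fun z hz ↦ by
    have h1 := mem_ball_zero_iff.1 hz
    have h2 : dist z₀ z₁ ≤ ρ := mem_closedBall.1 (hAD hz₀).2
    have h3 : dist (z₀ + L z) z₀ = ‖L z‖ := by simp [dist_eq_norm]
    have h4 := dist_triangle (z₀ + L z) z₀ z₁
    have h5 := hLn z
    rw [hK_def, mem_closedBall]
    nlinarith
  refine (hAD hz₀).1.2.2 (H r τ hr hτ (fun i ↦ (hrσ i).trans hσ1) hrτ z₀ hmaps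
    ((measure_mono ?_).trans hle))
  rintro z ⟨hz1, hz2⟩
  have hzK : z₀ + L z ∈ K := hmaps (closedBall_subset_ball one_lt_two hz1)
  refine ⟨hz1, hzK, ?_⟩
  rwa [mem_ofPred_eq, indicator_of_mem hzK]

end WidelyDegenerate

theorem mainTheorem3 (n : ℕ) (hn : 2 ≤ n)
    (Ω : Set (EuclideanSpace ℝ (Fin n))) (hΩ_open : IsOpen Ω) (hΩ_conn : IsConnected Ω)
    (hΩ_bdd : Bornology.IsBounded Ω) (T : ℝ) (hT : 0 < T)
    (p : Fin n → ℝ) (hp : ∀ i, 1 < p i) (δ : Fin n → ℝ) (hδ : ∀ i, 0 ≤ δ i)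
    (a : Fin n → EuclideanSpace ℝ (Fin n) × ℝ → ℝ)
    (ha_meas : ∀ i, AEMeasurable (a i) (volume.restrict (WidelyDegenerate.cylinder Ω T)))
    (Λ : ℝ) (hΛ : 1 ≤ Λ)
    (ha : ∀ i, ∀ᵐ z ∂(volume.restrict (WidelyDegenerate.cylinder Ω T)),
      Λ⁻¹ ≤ a i z ∧ a i z ≤ Λ)
    (u : EuclideanSpace ℝ (Fin n) × ℝ → ℝ) :
    (WidelyDegenerate.IsLocalWeakSupersolution Ω T p δ a u →
      WidelyDegenerate.LocallyBddBelow u (WidelyDegenerate.cylinder Ω T) →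
      WidelyDegenerate.HasLscRepresentative u (WidelyDegenerate.cylinder Ω T)) ∧
    (WidelyDegenerate.IsLocalWeakSubsolution Ω T p δ a u →
      WidelyDegenerate.LocallyBddAbove u (WidelyDegenerate.cylinder Ω T) →
      WidelyDegenerate.HasUscRepresentative u (WidelyDegenerate.cylinder Ω T)) := by
  refine ⟨fun hu hb ↦ hu.hasLscRepresentative hn hΩ_open hp hδ hΛ ha_meas ha hb, fun hu hb ↦ ?_⟩
  exact (hu.neg.hasLscRepresentative hn hΩ_open hp hδ hΛ ha_meas ha hb.neg).neg
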